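/- Let $n,m\ge 0$ and $k\ge 1$ be integers, let $\Lambda\subset\mathbb R^n\times\mathbb R^m$ be any subset, and let $k_n=\binom{k+n-1}{k}$ be the number of monomials of degree $k$ in $n$ variables. Let $\mathcal B_k$ be the set of polynomials $\Phi(\xi,\eta)=\sum_{j=1}^m\sum_{|\alpha|=k}\varphi_{\alpha j}\,\xi^\alpha\eta_j$ with $\varphi_{\alpha j}\in\mathbb R$. For $u:\mathbb R^n\to\mathbb R$ and $\xi\in\mathbb R^n$ put $D_\xi^j u(x)=\frac{d^j}{dt^j}u(x+t\xi)\big|_{t=0}$, and let $C^k_\xi$ be the set of continuous $u:\mathbb R^n\to\mathbb R$ such that $D^j_\xi u$ exists and is continuous on $\mathbb R^n$ for $j=1,\dots,k$. Then the following conditions are equivalent. (i) If $\Phi\in\mathcal B_k$ vanishes on $\Lambda$, then $\Phi\equiv 0$. (ii) There are $mk_n$ points $(\xi^{(p)},\eta^{(p)})\in\Lambda$, $1\le p\le mk_n$, such that the square matrix $\big[(\xi^{(p)})^\alpha\eta^{(p)}_j\big]$, with rows indexed by $p$ and columns indexed by the pairs $(\alpha,j)$ with $|\alpha|=k$ and $1\le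 j\le m$, has nonzero determinant. (iii) Every locally bounded $f:\mathbb R^n\to\mathbb R^m$ such that $\langle f,\eta\rangle\in C^k_\xi$ for all $(\xi,\eta)\in\Lambda$ is of class $C^k$. If any one of these conditions holds, then there is a constant $B\ge 0$, depending only on $n,m,k,\Lambda$, such that the following two statements hold (suprema are taken in $[0,\infty]$, with $0\cdot\infty=0$). (a) For every locally bounded $f:\mathbb R^n\to\mathbb R^m$ with $\langle f,\eta\rangle\in C^k_\xi$ for all $(\xi,\eta)\in\Lambda$, $$|\partial^\alpha f_j(x)|\le B\cdot\sup_{(\xi,\eta)\in\Lambda}\big|D^k_\xi\langle f,\eta\rangle(x)\big|\qquad\text{for all }x\in\mathbb R^n,\ |\alpha|=k,\ 1\le j\le m.$$ (b) Let $f:\mathbb R^n\to\mathbb R^m$ be locally bounded and measurable, and suppose that for every $(\xi,\eta)\in\Lambda$ the distribution $D^k_\xi\langle f,\eta\rangle$ is given by a locally integrable function $g_{\xi,\eta}$. Then for all $|\alpha|=k$ and $1\le j\le m$ the distribution $\partial^\alpha f_j$ is given by a locally integrable function $h_{\alpha j}$, continuous if all the $g_{\xi,\eta}$ are, such that $|h_{\alpha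 j}(x)|\le B\cdot\sup_{(\xi,\eta)\in\Lambda}|g_{\xi,\eta}(x)|$ for all $x\in\mathbb R^n$. -/

import Mathlib

open MeasureTheory Topology
open scoped NNReal ENNReal ContDiff

namespace PartialRegularity

/-- The Euclidean space `ℝⁿ`. -/
abbrev E (n : ℕ) : Type := EuclideanSpace ℝ (Fin n)

/-- Multi-indices `α ∈ ℤ₊ⁿ` with `|α| = k`. -/
abbrev MultiIndex (n k : ℕ) : Type := {α : Fin n → ℕ // ∑ i, α i = k}

noncomputable instance instFintypeMultiIndex (n k : ℕ) : Fintype (MultiIndex n k) :=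
  Fintype.ofEquiv _ (Sym.equivNatSumOfFintype (Fin n) k)

/-- `k_n`, the number of monomials of degree `k` in `n` variables. -/
def numMonomials (n k : ℕ) : ℕ := (k + n - 1).choose k

theorem card_multiIndex (n k : ℕ) : Fintype.card (MultiIndex n k) = numMonomials n k := by
  rw [← Fintype.card_congr (Sym.equivNatSumOfFintype (Fin n) k), Sym.card_sym_eq_choose,
    Fintype.card_fin, numMonomials, Nat.add_comm]

theorem card_columns (n m k : ℕ) :
    Fintype.card (MultiIndex n k × Fin m) = m * numMonomials n k := by
  rw [Fintype.card_prod, card_multiIndex, Fintype.card_fin, Nat.mul_comm]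

/-- An enumeration of the pairs `(α, j)`, `|α| = k`, `1 ≤ j ≤ m`. Another enumeration only
permutes the columns of the matrix `Delta` below. -/
noncomputable def columnEquiv (n m k : ℕ) :
    Fin (m * numMonomials n k) ≃ MultiIndex n k × Fin m :=
  (Fintype.equivFinOfCardEq (card_columns n m k)).symm

/-- The monomial `ξ^α`. -/
def monomial {n k : ℕ} (α : MultiIndex n k) (ξ : E n) : ℝ := ∏ i, ξ i ^ α.1 i

/-- The class `𝓑ₖ` of polynomials `Φ(ξ, η) = ∑_j ∑_{|α| = k} φ_{αj} ξ^α η_j` with real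
coefficients, regarded as functions. -/
def polyClass (n m k : ℕ) : Set (E n → E m → ℝ) :=
  {Φ | ∃ c : MultiIndex n k → Fin m → ℝ,
    ∀ ξ η, Φ ξ η = ∑ j, ∑ α, c α j * monomial α ξ * η j}

/-- The square matrix `[(ξ^{(p)})^α η_j^{(p)}]`, with rows indexed by the points. -/
noncomputable def Delta {n m : ℕ} (k : ℕ) (P : Fin (m * numMonomials n k) → E n × E m) :
    Matrix (Fin (m * numMonomials n k)) (Fin (m * numMonomials n k)) ℝ :=
  Matrix.of fun p c =>
    monomial (columnEquiv n m k c).1 (P p).1 * (P p).2 (columnEquiv n m k c).2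

/-- Every point has a neighbourhood on which `f` is bounded. -/
def IsLocallyBounded {n m : ℕ} (f : E n → E m) : Prop :=
  ∀ x, ∃ U ∈ 𝓝 x, Bornology.IsBounded (f '' U)

/-- `D_ξ^j u (x) = d^j/dt^j u(x + tξ)` at `t = 0`. -/
noncomputable def dirDeriv {n : ℕ} (j : ℕ) (ξ : E n) (u : E n → ℝ) (x : E n) : ℝ :=
  iteratedDeriv j (fun t : ℝ => u (x + t • ξ)) 0

/-- `u ∈ C^k_ξ(ℝⁿ)`: `u` is continuous, and `D_ξ^j u`, `1 ≤ j ≤ k`, exist and are continuous. -/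
def IsDirCk {n : ℕ} (k : ℕ) (ξ : E n) (u : E n → ℝ) : Prop :=
  Continuous u ∧
  (∀ x, ∀ j < k, Differentiable ℝ (iteratedDeriv j (fun t : ℝ => u (x + t • ξ)))) ∧
  ∀ j, 1 ≤ j → j ≤ k → Continuous (dirDeriv j ξ u)

/-- The scalar function `⟨f, η⟩`. -/
noncomputable def pairing {n m : ℕ} (f : E n → E m) (η : E m) : E n → ℝ :=
  fun x => inner ℝ (f x) η

/-- The first-order partial derivative `∂_i u`. -/
noncomputable def partialDeriv {n : ℕ} (i : Fin n) (u : E n → ℝ) : E n → ℝ :=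
  fun x => lineDeriv ℝ u x (EuclideanSpace.single i 1)

/-- The partial derivative `∂^α u = ∂_1^{α_1} ⋯ ∂_n^{α_n} u`. -/
noncomputable def multiDeriv {n : ℕ} (α : Fin n → ℕ) (u : E n → ℝ) : E n → ℝ :=
  (List.finRange n).foldr (fun i v => (partialDeriv i)^[α i] v) u

/-- Smooth functions with compact support. -/
def IsTestFunction {n : ℕ} (φ : E n → ℝ) : Prop :=
  ContDiff ℝ ∞ φ ∧ HasCompactSupport φ

/-- `D_ξ^k u = g` in the sense of distributions. -/
def IsWeakDirDeriv {n : ℕ} (k : ℕ) (ξ : E n) (u g : E n → ℝ) : Prop :=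
  ∀ φ, IsTestFunction φ →
    ∫ x, u x * dirDeriv k ξ φ x = (-1) ^ k * ∫ x, g x * φ x

/-- `∂^α u = h` in the sense of distributions. -/
def IsWeakMultiDeriv {n : ℕ} (α : Fin n → ℕ) (u h : E n → ℝ) : Prop :=
  ∀ φ, IsTestFunction φ →
    ∫ x, u x * multiDeriv α φ x = (-1) ^ (∑ i, α i) * ∫ x, h x * φ x

/-- An element of `𝓑ₖ` that vanishes on `Λ` vanishes identically. -/
def NotInHypersurface {n m : ℕ} (k : ℕ) (Λ : Set (E n × E m)) : Prop :=
  ∀ Φ ∈ polyClass n m k, (∀ p ∈ Λ, Φ p.1 p.2 = 0) → ∀ ξ η, Φ ξ η = 0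

/-- Some `m * k_n` points of `Λ` give a nonsingular matrix. -/
def HasNonsingularPoints {n m : ℕ} (k : ℕ) (Λ : Set (E n × E m)) : Prop :=
  ∃ P : Fin (m * numMonomials n k) → E n × E m, (∀ p, P p ∈ Λ) ∧ (Delta k P).det ≠ 0

/-- Partial regularity along `Λ` forces regularity. -/
def ForcesCk {n m : ℕ} (k : ℕ) (Λ : Set (E n × E m)) : Prop :=
  ∀ f : E n → E m, IsLocallyBounded f →
    (∀ p ∈ Λ, IsDirCk k p.1 (pairing f p.2)) → ContDiff ℝ k f

end PartialRegularity

namespace PartialRegularity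

variable {n m k : ℕ}

/-! ### Iterated partial derivatives along words -/

/-- The iterated partial derivative `∂_{i₁} ⋯ ∂_{i_r} u` along the word `l = [i₁, …, i_r]`. -/
noncomputable def wordDeriv (l : List (Fin n)) (u : E n → ℝ) : E n → ℝ :=
  l.foldr partialDeriv u

@[simp] theorem wordDeriv_nil (u : E n → ℝ) : wordDeriv [] u = u := rfl

@[simp] theorem wordDeriv_cons (i : Fin n) (l : List (Fin n)) (u : E n → ℝ) :
    wordDeriv (i :: l) u = partialDeriv i (wordDeriv l u) := rfl

theorem wordDeriv_append (l l' : List (Fin n)) (u : E n → ℝ) :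
    wordDeriv (l ++ l') u = wordDeriv l (wordDeriv l' u) := by
  simp [wordDeriv, List.foldr_append]

theorem wordDeriv_replicate (r : ℕ) (i : Fin n) (u : E n → ℝ) :
    wordDeriv (List.replicate r i) u = (partialDeriv i)^[r] u := by
  induction r with
  | zero => rfl
  | succ r ih => rw [List.replicate_succ, wordDeriv_cons, ih, Function.iterate_succ_apply']

theorem partialDeriv_eq_fderiv {u : E n → ℝ} (hu : Differentiable ℝ u) (i : Fin n) :
    partialDeriv i u = fun x => fderiv ℝ u x (EuclideanSpace.single i 1) := by
  funext x
  exact (hu x).lineDeriv_eq_fderiv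

theorem contDiff_partialDeriv {r : ℕ} {u : E n → ℝ} (hu : ContDiff ℝ (r + 1 : ℕ) u) (i : Fin n) :
    ContDiff ℝ r (partialDeriv i u) := by
  rw [partialDeriv_eq_fderiv (hu.differentiable (by simp))]
  exact (hu.fderiv_right (by norm_cast)).clm_apply contDiff_const

theorem contDiff_wordDeriv {r : ℕ} (l : List (Fin n)) {u : E n → ℝ}
    (hu : ContDiff ℝ (r + l.length : ℕ) u) : ContDiff ℝ r (wordDeriv l u) := by
  induction l generalizing r with
  | nil => simpa using hu
  | cons i l ih =>
    refine contDiff_partialDeriv (ih ?_) i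
    convert hu using 2
    simp only [List.length_cons]
    ring

theorem partialDeriv_comm {u : E n → ℝ} (hu : ContDiff ℝ (2 : ℕ) u) (i j : Fin n) :
    partialDeriv i (partialDeriv j u) = partialDeriv j (partialDeriv i u) := by
  have h1 : Differentiable ℝ u := hu.differentiable (by simp)
  have h2 : Differentiable ℝ (fderiv ℝ u) :=
    (hu.fderiv_right (m := 1) (by norm_num)).differentiable (by simp)
  have h3 : ∀ a b : Fin n, partialDeriv a (partialDeriv b u) = fun x =>
      fderiv ℝ (fderiv ℝ u) x (EuclideanSpace.single a 1) (EuclideanSpace.single b 1) := by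
    intro a b
    rw [partialDeriv_eq_fderiv ((contDiff_partialDeriv (r := 1) hu b).differentiable (by simp)),
      partialDeriv_eq_fderiv h1]
    funext x
    rw [fderiv_clm_apply (h2 x) (differentiableAt_const _)]
    simp
  rw [h3, h3]
  funext x
  have h4 : IsSymmSndFDerivAt ℝ u x :=
    hu.contDiffAt.isSymmSndFDerivAt (by simp)
  exact h4 _ _

theorem wordDeriv_perm {l l' : List (Fin n)} (h : l.Perm l') {u : E n → ℝ}
    (hu : ContDiff ℝ l.length u) : wordDeriv l u = wordDeriv l' u := by
  induction h with
  | nil => rfl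
  | cons a h ih =>
    rw [wordDeriv_cons, wordDeriv_cons, ih (hu.of_le (by simp))]
  | swap a b l =>
    simp only [wordDeriv_cons]
    refine partialDeriv_comm (contDiff_wordDeriv l ?_) _ _
    convert hu using 2
    simp only [List.length_cons]
    ring
  | trans h1 h2 ih1 ih2 => rw [ih1 hu, ih2 (by rwa [← h1.length_eq])]

/-- The nondecreasing word with `α i` letters `i`. -/
def multiWord (α : Fin n → ℕ) : List (Fin n) :=
  (List.finRange n).flatMap fun i => List.replicate (α i) i

theorem multiDeriv_eq_wordDeriv (α : Fin n → ℕ) (u : E n → ℝ) :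
    multiDeriv α u = wordDeriv (multiWord α) u := by
  rw [multiDeriv, wordDeriv, multiWord, List.foldr_flatMap]
  congr 1
  funext i v
  exact (wordDeriv_replicate (α i) i v).symm

theorem count_multiWord (α : Fin n → ℕ) (i : Fin n) : (multiWord α).count i = α i := by
  rw [multiWord, List.count_flatMap]
  have : (List.count i ∘ fun i => List.replicate (α i) i) = fun j => if j = i then α j else 0 := by
    funext j
    simp [List.count_replicate]
  rw [this, ← List.ofFn_eq_map, List.sum_ofFn]
  simp

theorem length_multiWord (α : Fin n → ℕ) : (multiWord α).length = ∑ i, α i := by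
  rw [multiWord, List.length_flatMap]
  simp only [List.length_replicate]
  rw [← List.ofFn_eq_map, List.sum_ofFn]

/-! ### Directional derivatives -/

/-- The content of a word, as a multi-index. -/
def contentOf {k : ℕ} (w : Fin k → Fin n) : MultiIndex n k :=
  ⟨fun i => (List.ofFn w).count i, by
    simpa using (List.ofFn w).toFinset.sum_subset (Finset.subset_univ _)
      (fun i _ hi => by simpa [List.count_eq_zero] using hi) |>.symm.trans
      (List.sum_toFinset_count_eq_length (List.ofFn w))⟩

theorem contentOf_surjective {k : ℕ} : Function.Surjective (contentOf (n := n) (k := k)) := by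
  rintro ⟨α, rfl⟩
  have h := length_multiWord α
  refine ⟨fun p => (multiWord α).get (p.cast h.symm), Subtype.ext ?_⟩
  funext i
  simp only [contentOf]
  have : List.ofFn (fun p : Fin (∑ i, α i) => (multiWord α).get (p.cast h.symm)) = multiWord α := by
    rw [← List.ofFn_congr h]
    exact List.ofFn_get _
  rw [this, count_multiWord]

theorem prod_word_eq_monomial {k : ℕ} (w : Fin k → Fin n) (ξ : E n) :
    ∏ p, ξ (w p) = monomial (contentOf w) ξ := by
  rw [monomial, ← List.prod_ofFn]
  have : List.ofFn (fun p => ξ (w p)) = (List.ofFn w).map (fun i => ξ i) := by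
    rw [List.map_ofFn]; rfl
  rw [this, Finset.prod_list_map_count]
  refine Finset.prod_subset (Finset.subset_univ _) fun i _ hi => ?_
  rw [List.count_eq_zero.2 (by simpa using hi), pow_zero]

theorem wordDeriv_ofFn {k : ℕ} (w : Fin k → Fin n) {u : E n → ℝ} (hu : ContDiff ℝ k u) :
    wordDeriv (List.ofFn w) u = multiDeriv (contentOf w).1 u := by
  rw [multiDeriv_eq_wordDeriv]
  refine wordDeriv_perm ?_ (by simpa using hu)
  rw [List.perm_iff_count]
  intro i
  rw [count_multiWord]
  rfl

theorem hasDerivAt_comp_line {u : E n → ℝ} (hu : Differentiable ℝ u) (x ξ : E n) (t : ℝ) :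
    HasDerivAt (fun t : ℝ => u (x + t • ξ)) (∑ i, ξ i * partialDeriv i u (x + t • ξ)) t := by
  have h1 : HasDerivAt (fun t : ℝ => x + t • ξ) ξ t := by
    simpa using ((hasDerivAt_id t).smul_const ξ).const_add x
  have h2 := (hu (x + t • ξ)).hasFDerivAt.comp_hasDerivAt t h1
  refine h2.congr_deriv ?_
  have hξ := congrArg (fderiv ℝ u (x + t • ξ)) ((EuclideanSpace.basisFun (Fin n) ℝ).sum_repr ξ)
  rw [← hξ, map_sum]
  refine Finset.sum_congr rfl fun i _ => ?_
  rw [partialDeriv_eq_fderiv hu]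
  simp

theorem iteratedDeriv_comp_line {k : ℕ} {u : E n → ℝ} (hu : ContDiff ℝ k u) (x ξ : E n) :
    iteratedDeriv k (fun t : ℝ => u (x + t • ξ)) = fun t =>
      ∑ w : Fin k → Fin n, (∏ p, ξ (w p)) * wordDeriv (List.ofFn w) u (x + t • ξ) := by
  induction k with
  | zero => funext t; simp
  | succ k ih =>
    rw [iteratedDeriv_succ, ih (hu.of_le (by norm_cast; simp))]
    funext t
    have hw : ∀ w : Fin k → Fin n, Differentiable ℝ (wordDeriv (List.ofFn w) u) := fun w =>
      (contDiff_wordDeriv (r := 1) _ (by simpa [add_comm] using hu)).differentiable (by simp)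
    have := HasDerivAt.fun_sum (u := Finset.univ) fun (w : Fin k → Fin n) _ =>
      (hasDerivAt_comp_line (hw w) x ξ t).const_mul (∏ p, ξ (w p))
    rw [this.deriv, ← (Fin.consEquiv fun _ : Fin (k + 1) => Fin n).sum_comp, Fintype.sum_prod_type,
      Finset.sum_comm]
    refine Finset.sum_congr rfl fun w _ => ?_
    rw [Finset.mul_sum]
    refine Finset.sum_congr rfl fun i _ => ?_
    simp [Fin.consEquiv, Fin.prod_univ_succ, List.ofFn_succ]
    ring

/-- The number of words with content `α`. -/
def wordCount {k : ℕ} (α : MultiIndex n k) : ℕ :=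
  (Finset.univ.filter fun w : Fin k → Fin n => contentOf w = α).card

theorem wordCount_ne_zero {k : ℕ} (α : MultiIndex n k) : (wordCount α : ℝ) ≠ 0 := by
  obtain ⟨w, hw⟩ := contentOf_surjective α
  exact_mod_cast Finset.card_ne_zero_of_mem (Finset.mem_filter.2 ⟨Finset.mem_univ w, hw⟩)

theorem iteratedDeriv_comp_line_eq_sum {k : ℕ} {u : E n → ℝ} (hu : ContDiff ℝ k u) (x ξ : E n)
    (t : ℝ) :
    iteratedDeriv k (fun t : ℝ => u (x + t • ξ)) t =
      ∑ α : MultiIndex n k, wordCount α * monomial α ξ * multiDeriv α.1 u (x + t • ξ) := by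
  rw [iteratedDeriv_comp_line hu]
  beta_reduce
  rw [← Finset.sum_fiberwise Finset.univ (contentOf (n := n) (k := k))]
  refine Finset.sum_congr rfl fun α _ => ?_
  rw [Finset.sum_congr rfl (g := fun _ => monomial α ξ * multiDeriv α.1 u (x + t • ξ))]
  · rw [Finset.sum_const, nsmul_eq_mul, mul_assoc]
    rfl
  · intro w hw
    rw [Finset.mem_filter] at hw
    rw [prod_word_eq_monomial, wordDeriv_ofFn w hu, hw.2]

theorem dirDeriv_eq_sum {k : ℕ} {u : E n → ℝ} (hu : ContDiff ℝ k u) (ξ x : E n) :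
    dirDeriv k ξ u x =
      ∑ α : MultiIndex n k, wordCount α * monomial α ξ * multiDeriv α.1 u x := by
  rw [dirDeriv, iteratedDeriv_comp_line_eq_sum hu]
  simp

/-- Along a line, the iterated derivative is the directional derivative at the moving point. -/
theorem iteratedDeriv_comp_line_eq_dirDeriv (k : ℕ) (u : E n → ℝ) (ξ x : E n) (t : ℝ) :
    iteratedDeriv k (fun t : ℝ => u (x + t • ξ)) t = dirDeriv k ξ u (x + t • ξ) := by
  have := congrFun (iteratedDeriv_comp_const_add k (fun t : ℝ => u (x + t • ξ)) t) 0
  simp only [add_zero] at this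
  rw [dirDeriv, ← this]
  simp only [add_smul, add_assoc]

theorem continuous_multiDeriv {k : ℕ} {u : E n → ℝ} (hu : ContDiff ℝ k u) (α : MultiIndex n k) :
    Continuous (multiDeriv α.1 u) := by
  rw [multiDeriv_eq_wordDeriv]
  exact (contDiff_wordDeriv (r := 0) _
    (by rw [length_multiWord, α.2, zero_add]; exact hu)).continuous

theorem continuous_dirDeriv {k : ℕ} {u : E n → ℝ} (hu : ContDiff ℝ k u) (ξ : E n) :
    Continuous (dirDeriv k ξ u) := by
  have : dirDeriv k ξ u = fun x =>
      ∑ α : MultiIndex n k, wordCount α * monomial α ξ * multiDeriv α.1 u x :=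
    funext (dirDeriv_eq_sum hu ξ)
  rw [this]
  exact continuous_finsetSum _ fun α _ => continuous_const.mul (continuous_multiDeriv hu α)

/-! ### The algebraic conditions -/

theorem exists_dual_coefficients {Λ : Set (E n × E m)} (h : HasNonsingularPoints k Λ) :
    ∃ P : Fin (m * numMonomials n k) → E n × E m, (∀ p, P p ∈ Λ) ∧
      ∃ A : MultiIndex n k → Fin m → Fin (m * numMonomials n k) → ℝ, ∀ α j β i,
        ∑ p, A α j p * (monomial β (P p).1 * (P p).2 i) = if (α, j) = (β, i) then 1 else 0 := by
  obtain ⟨P, hP, hdet⟩ := h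
  refine ⟨P, hP, fun α j p => (Delta k P)⁻¹ ((columnEquiv n m k).symm (α, j)) p, ?_⟩
  intro α j β i
  have h1 : (Delta k P)⁻¹ * Delta k P = 1 := Matrix.nonsing_inv_mul _ (Ne.isUnit hdet)
  have h2 := congrFun (congrFun h1 ((columnEquiv n m k).symm (α, j)))
    ((columnEquiv n m k).symm (β, i))
  rw [Matrix.mul_apply, Matrix.one_apply] at h2
  simpa [Delta] using h2

theorem dual_coefficients_apply {N : ℕ} {P : Fin N → E n × E m}
    {A : MultiIndex n k → Fin m → Fin N → ℝ}
    (hA : ∀ α j β i,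
      ∑ p, A α j p * (monomial β (P p).1 * (P p).2 i) = if (α, j) = (β, i) then 1 else 0)
    (T : MultiIndex n k → Fin m → ℝ) (α : MultiIndex n k) (j : Fin m) :
    ∑ p, A α j p * ∑ i, ∑ β, monomial β (P p).1 * (P p).2 i * T β i = T α j := by
  calc ∑ p, A α j p * ∑ i, ∑ β, monomial β (P p).1 * (P p).2 i * T β i
      = ∑ i, ∑ β, (∑ p, A α j p * (monomial β (P p).1 * (P p).2 i)) * T β i := by
        simp only [Finset.mul_sum, Finset.sum_mul]
        rw [Finset.sum_comm]
        refine Finset.sum_congr rfl fun i _ => ?_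
        rw [Finset.sum_comm]
        refine Finset.sum_congr rfl fun β _ => Finset.sum_congr rfl fun p _ => ?_
        ring
    _ = T α j := by
        simp only [hA, Prod.mk.injEq, ite_mul, one_mul, zero_mul]
        rw [Finset.sum_eq_single j, Finset.sum_eq_single α]
        · simp
        · intro β _ hβ
          simp [hβ.symm]
        · simp
        · intro i _ hi
          simp [hi.symm]
        · simp

theorem notInHypersurface_of_hasNonsingularPoints {Λ : Set (E n × E m)}
    (h : HasNonsingularPoints k Λ) : NotInHypersurface k Λ := by
  obtain ⟨P, hP, A, hA⟩ := exists_dual_coefficients h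
  rintro Φ ⟨c, hc⟩ hΦ ξ η
  have hc0 : ∀ α j, c α j = 0 := by
    intro α j
    rw [← dual_coefficients_apply hA c α j]
    refine Finset.sum_eq_zero fun p _ => ?_
    have := hΦ _ (hP p)
    rw [hc] at this
    rw [← mul_zero (A α j p), ← this]
    congr 1
    refine Finset.sum_congr rfl fun i _ => Finset.sum_congr rfl fun β _ => ?_
    ring
  rw [hc]
  simp [hc0]

theorem monomials_linearIndependent {c : MultiIndex n k → ℝ}
    (hc : ∀ ξ : E n, ∑ α, c α * monomial α ξ = 0) : c = 0 := by
  let e : MultiIndex n k → (Fin n →₀ ℕ) := fun α => Finsupp.equivFunOnFinite.symm α.1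
  have he : Function.Injective e := fun α β h =>
    Subtype.ext (Finsupp.equivFunOnFinite.symm.injective h)
  have hp : (∑ α, MvPolynomial.monomial (e α) (c α) : MvPolynomial (Fin n) ℝ) = 0 := by
    refine MvPolynomial.funext fun x => ?_
    rw [map_sum, map_zero, ← hc (WithLp.toLp 2 x)]
    refine Finset.sum_congr rfl fun α _ => ?_
    rw [MvPolynomial.eval_monomial, monomial, Finsupp.prod_fintype _ _ (by simp)]
    simp [e]
  funext α
  have := congrArg (MvPolynomial.coeff (e α)) hp
  rw [MvPolynomial.coeff_sum] at this
  simpa [MvPolynomial.coeff_monomial, he.eq_iff] using this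

/-- The vector of the values `ξ^α η_j`. -/
def evalVector (k : ℕ) (p : E n × E m) : MultiIndex n k × Fin m → ℝ :=
  fun c => monomial c.1 p.1 * p.2 c.2

theorem span_evalVector_eq_top {Λ : Set (E n × E m)} (h : NotInHypersurface k Λ) :
    Submodule.span ℝ (evalVector k '' Λ) = ⊤ := by
  by_contra hne
  obtain ⟨φ, hφ, hker⟩ := Submodule.exists_le_ker_of_lt_top _ (lt_top_iff_ne_top.2 hne)
  have hφv : ∀ v, φ v = ∑ c, φ (Pi.single c 1) * v c := fun v => by
    conv_lhs => rw [pi_eq_sum_univ' v, map_sum]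
    refine Finset.sum_congr rfl fun c _ => ?_
    rw [map_smul, smul_eq_mul, mul_comm]
  have hΦ := h (fun ξ η => ∑ j, ∑ α, φ (Pi.single (α, j) 1) * monomial α ξ * η j)
    ⟨fun α j => φ (Pi.single (α, j) 1), fun _ _ => rfl⟩ (fun p hp => by
      have h1 : φ (evalVector k p) = 0 :=
        hker (Submodule.subset_span (Set.mem_image_of_mem _ hp))
      rw [hφv, Fintype.sum_prod_type, Finset.sum_comm] at h1
      rw [← h1]
      refine Finset.sum_congr rfl fun i _ => Finset.sum_congr rfl fun β _ => ?_
      rw [evalVector, mul_assoc])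
  apply hφ
  have h0 : ∀ j, (fun α => φ (Pi.single (α, j) 1)) = 0 := by
    intro j
    refine monomials_linearIndependent fun ξ => ?_
    rw [← hΦ ξ (EuclideanSpace.single j 1), Finset.sum_eq_single j]
    · simp
    · intro i _ hi
      simp [hi]
    · simp
  ext c
  simpa using congrFun (h0 c.2) c.1

theorem hasNonsingularPoints_of_notInHypersurface {Λ : Set (E n × E m)}
    (h : NotInHypersurface k Λ) : HasNonsingularPoints k Λ := by
  obtain ⟨b, hb, hspan, hli⟩ := exists_linearIndependent ℝ (evalVector k '' Λ)
  rw [span_evalVector_eq_top h] at hspan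
  let B := Module.Basis.mk hli (by simp [hspan])
  have : Finite b := Module.Finite.finite_basis B
  have : Fintype b := Fintype.ofFinite _
  have hcard : Fintype.card b = m * numMonomials n k := by
    rw [← card_columns, ← Module.finrank_eq_card_basis B, Module.finrank_pi]
  let e : Fin (m * numMonomials n k) ≃ b := (Fintype.equivFinOfCardEq hcard).symm
  choose P hPΛ hP using fun v : b => hb v.2
  refine ⟨fun p => P (e p), fun p => hPΛ _, ?_⟩
  rw [← isUnit_iff_ne_zero, ← Matrix.isUnit_iff_isUnit_det,
    ← Matrix.linearIndependent_rows_iff_isUnit]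
  have h1 : LinearIndependent ℝ fun p => (e p : MultiIndex n k × Fin m → ℝ) :=
    hli.comp e e.injective
  have h2 := h1.map' (LinearMap.funLeft ℝ ℝ (columnEquiv n m k))
    (LinearMap.ker_eq_bot.2
      (LinearMap.funLeft_injective_of_surjective ℝ ℝ _ (columnEquiv n m k).surjective))
  have h3 : (Delta k fun p => P (e p)).row =
      LinearMap.funLeft ℝ ℝ (columnEquiv n m k) ∘ fun p => (e p : MultiIndex n k × Fin m → ℝ) := by
    funext p c
    simp only [Function.comp_apply, LinearMap.funLeft_apply]
    rw [← hP (e p)]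
    rfl
  rw [h3]
  exact h2

theorem notInHypersurface_iff_hasNonsingularPoints {Λ : Set (E n × E m)} :
    NotInHypersurface k Λ ↔ HasNonsingularPoints k Λ :=
  ⟨hasNonsingularPoints_of_notInHypersurface, notInHypersurface_of_hasNonsingularPoints⟩

/-! ### Estimates for derivatives of order `k` -/

theorem enorm_sum_mul_le_iSup {N : ℕ} {ι : Type*} {Λ : Set ι} {P : Fin N → ι}
    (hP : ∀ p, P p ∈ Λ) (a : Fin N → ℝ) (v : ι → ℝ) :
    ‖∑ p, a p * v (P p)‖ₑ ≤ ((∑ p, ‖a p‖₊ : ℝ≥0) : ℝ≥0∞) * ⨆ q ∈ Λ, ‖v q‖ₑ := by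
  refine (enorm_sum_le _ _).trans ?_
  push_cast
  rw [Finset.sum_mul]
  refine Finset.sum_le_sum fun p _ => ?_
  rw [enorm_mul]
  exact mul_le_mul_right (le_iSup₂ (f := fun q (_ : q ∈ Λ) => ‖v q‖ₑ) (P p) (hP p)) _

theorem pairing_eq_sum (f : E n → E m) (η : E m) :
    pairing f η = fun x => ∑ j, η j * f x j := by
  funext x
  rw [pairing, PiLp.inner_apply]
  simp

theorem contDiff_apply_coord {f : E n → E m} (hf : ContDiff ℝ k f) (j : Fin m) :
    ContDiff ℝ k fun x => f x j :=
  contDiff_euclidean.1 hf j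

theorem dirDeriv_pairing {f : E n → E m} (hf : ContDiff ℝ k f) (ξ : E n) (η : E m) (x : E n) :
    dirDeriv k ξ (pairing f η) x =
      ∑ j, ∑ α : MultiIndex n k, monomial α ξ * η j *
        (wordCount α * multiDeriv α.1 (fun y => f y j) x) := by
  have hd : ContDiff ℝ k fun t : ℝ => x + t • ξ :=
    contDiff_const.add (contDiff_id.smul contDiff_const)
  have hj : ∀ j, ContDiff ℝ k fun t : ℝ => f (x + t • ξ) j := fun j =>
    (contDiff_apply_coord hf j).comp hd
  rw [dirDeriv, pairing_eq_sum,
    iteratedDeriv_fun_sum fun j _ => (contDiff_const.mul (hj j)).contDiffAt]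
  refine Finset.sum_congr rfl fun j _ => ?_
  rw [iteratedDeriv_const_mul _ (hj j).contDiffAt]
  have := dirDeriv_eq_sum (contDiff_apply_coord hf j) ξ x
  rw [dirDeriv] at this
  rw [this, Finset.mul_sum]
  refine Finset.sum_congr rfl fun α _ => ?_
  ring

theorem multiDeriv_eq_sum_dirDeriv {N : ℕ} {P : Fin N → E n × E m}
    {A : MultiIndex n k → Fin m → Fin N → ℝ}
    (hA : ∀ α j β i,
      ∑ p, A α j p * (monomial β (P p).1 * (P p).2 i) = if (α, j) = (β, i) then 1 else 0)
    {f : E n → E m} (hf : ContDiff ℝ k f) (α : MultiIndex n k) (j : Fin m) (x : E n) :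
    multiDeriv α.1 (fun y => f y j) x =
      ∑ p, (wordCount α : ℝ)⁻¹ * A α j p * dirDeriv k (P p).1 (pairing f (P p).2) x := by
  have h1 := dual_coefficients_apply hA
    (fun α j => wordCount α * multiDeriv α.1 (fun y => f y j) x) α j
  rw [← inv_mul_cancel_left₀ (wordCount_ne_zero α) (multiDeriv α.1 (fun y => f y j) x), ← h1,
    Finset.mul_sum]
  refine Finset.sum_congr rfl fun p _ => ?_
  rw [dirDeriv_pairing hf, mul_assoc]

/-! ### Weak derivatives -/

theorem IsTestFunction.contDiff {φ : E n → ℝ} (hφ : IsTestFunction φ) (r : ℕ) : ContDiff ℝ r φ :=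
  hφ.1.of_le (by exact_mod_cast le_top)

theorem hasCompactSupport_partialDeriv {φ : E n → ℝ} (hφ : HasCompactSupport φ)
    (hd : Differentiable ℝ φ) (i : Fin n) : HasCompactSupport (partialDeriv i φ) := by
  rw [partialDeriv_eq_fderiv hd]
  exact hφ.fderiv_apply ℝ _

theorem IsTestFunction.partialDeriv {φ : E n → ℝ} (hφ : IsTestFunction φ) (i : Fin n) :
    IsTestFunction (partialDeriv i φ) := by
  have hd : Differentiable ℝ φ := (hφ.contDiff 1).differentiable (by simp)
  refine ⟨?_, hasCompactSupport_partialDeriv hφ.2 hd i⟩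
  rw [partialDeriv_eq_fderiv hd]
  exact (hφ.1.fderiv_right (by simp)).clm_apply contDiff_const

theorem IsTestFunction.multiDeriv {φ : E n → ℝ} (hφ : IsTestFunction φ) (α : Fin n → ℕ) :
    IsTestFunction (multiDeriv α φ) := by
  rw [multiDeriv_eq_wordDeriv]
  generalize multiWord α = l
  induction l with
  | nil => exact hφ
  | cons i l ih => exact ih.partialDeriv i

theorem IsLocallyBounded.locallyIntegrable_coord {f : E n → E m} (hf : IsLocallyBounded f)
    (hm : AEStronglyMeasurable f volume) (j : Fin m) :
    LocallyIntegrable (fun x => f x j) volume := by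
  have hmj : AEStronglyMeasurable (fun x => f x j) volume :=
    (EuclideanSpace.proj (𝕜 := ℝ) j).continuous.comp_aestronglyMeasurable hm
  intro x
  obtain ⟨U, hU, hb⟩ := hf x
  obtain ⟨C, hC⟩ := hb.exists_norm_le
  obtain ⟨V, hVU, hV, hxV⟩ := mem_nhds_iff.1 (Filter.inter_mem hU (Metric.ball_mem_nhds x one_pos))
  refine ⟨V, hV.mem_nhds hxV, ?_⟩
  refine Measure.integrableOn_of_bounded (M := C)
    (ne_top_of_le_ne_top Metric.isBounded_ball.measure_lt_top.ne
      (measure_mono (hVU.trans Set.inter_subset_right))) hmj ?_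
  refine (ae_restrict_iff' hV.measurableSet).2 (Filter.Eventually.of_forall fun y hy => ?_)
  exact (PiLp.norm_apply_le (f y) j).trans (hC _ (Set.mem_image_of_mem f (hVU hy).1))

theorem IsTestFunction.integrable_mul {φ : E n → ℝ} (hφ : IsTestFunction φ) {u : E n → ℝ}
    (hu : LocallyIntegrable u volume) : Integrable (fun x => u x * φ x) volume := by
  simpa [mul_comm] using hu.integrable_smul_left_of_hasCompactSupport hφ.1.continuous hφ.2

theorem isWeakMultiDeriv_of_isWeakDirDeriv {N : ℕ} {P : Fin N → E n × E m}
    {A : MultiIndex n k → Fin m → Fin N → ℝ}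
    (hA : ∀ α j β i,
      ∑ p, A α j p * (monomial β (P p).1 * (P p).2 i) = if (α, j) = (β, i) then 1 else 0)
    {f : E n → E m} (hf : ∀ j, LocallyIntegrable (fun x => f x j) volume)
    {g : Fin N → E n → ℝ} (hg : ∀ p, LocallyIntegrable (g p) volume)
    (hw : ∀ p, IsWeakDirDeriv k (P p).1 (pairing f (P p).2) (g p))
    (α : MultiIndex n k) (j : Fin m) :
    IsWeakMultiDeriv α.1 (fun y => f y j)
      (fun x => ∑ p, (wordCount α : ℝ)⁻¹ * A α j p * g p x) := by
  intro φ hφ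
  have hint : ∀ (β : MultiIndex n k) (i : Fin m),
      Integrable (fun x => f x i * multiDeriv β.1 φ x) volume := fun β i =>
    (hφ.multiDeriv β.1).integrable_mul (hf i)
  have h1 := dual_coefficients_apply hA
    (fun β i => wordCount β * ∫ x, f x i * multiDeriv β.1 φ x) α j
  have h2 : ∀ p, ∑ i, ∑ β : MultiIndex n k, monomial β (P p).1 * (P p).2 i *
      (wordCount β * ∫ x, f x i * multiDeriv β.1 φ x) = (-1) ^ k * ∫ x, g p x * φ x := by
    intro p
    rw [← hw p φ hφ]
    have h3 : ∀ x, pairing f (P p).2 x * dirDeriv k (P p).1 φ x =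
        ∑ i, ∑ β : MultiIndex n k, monomial β (P p).1 * (P p).2 i * wordCount β *
          (f x i * multiDeriv β.1 φ x) := by
      intro x
      rw [pairing_eq_sum, dirDeriv_eq_sum (hφ.contDiff k), Finset.sum_mul]
      refine Finset.sum_congr rfl fun i _ => ?_
      rw [Finset.mul_sum]
      refine Finset.sum_congr rfl fun β _ => ?_
      ring
    simp only [h3]
    rw [integral_finsetSum _ fun i _ => integrable_finsetSum _ fun β _ => (hint β i).const_mul _]
    refine Finset.sum_congr rfl fun i _ => ?_
    rw [integral_finsetSum _ fun β _ => (hint β i).const_mul _]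
    refine Finset.sum_congr rfl fun β _ => ?_
    rw [integral_const_mul]
    ring
  simp only [h2] at h1
  rw [← inv_mul_cancel_left₀ (wordCount_ne_zero α) (∫ x, f x j * multiDeriv α.1 φ x), ← h1, α.2]
  simp only [Finset.sum_mul, mul_assoc]
  rw [integral_finsetSum _ fun p _ => ((hφ.integrable_mul (hg p)).const_mul _).const_mul _,
    Finset.mul_sum, Finset.mul_sum]
  refine Finset.sum_congr rfl fun p _ => ?_
  rw [integral_const_mul, integral_const_mul]
  ring

/-! ### An interpolation inequality on the line -/

theorem exists_abs_iteratedDeriv_le (k : ℕ) {v : ℝ → ℝ} (hv : ContDiff ℝ k v) {a M : ℝ}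
    (hM : ∀ t ∈ Set.Icc a (a + 3 ^ k), |v t| ≤ M) :
    ∃ t ∈ Set.Icc a (a + 3 ^ k), |iteratedDeriv k v t| ≤ 2 ^ k * M := by
  induction k generalizing a with
  | zero => exact ⟨a, by simp, by simpa using hM a (by simp)⟩
  | succ k ih =>
    have hL : (1 : ℝ) ≤ 3 ^ k := one_le_pow₀ (by norm_num)
    have hLs : (3 : ℝ) ^ (k + 1) = 3 * 3 ^ k := by ring
    rw [hLs] at hM ⊢
    have hv' : ContDiff ℝ k v := hv.of_le (by norm_cast; simp)
    obtain ⟨s, hs, hs'⟩ := ih hv' (a := a) fun t ht => hM t ⟨ht.1, by linarith [ht.2]⟩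
    obtain ⟨t, ht, ht'⟩ := ih hv' (a := a + 2 * 3 ^ k) fun t ht =>
      hM t ⟨by linarith [ht.1], by linarith [ht.2]⟩
    have hst : 1 ≤ t - s := by linarith [hs.2, ht.1]
    have hd : Differentiable ℝ (iteratedDeriv k v) :=
      hv.differentiable_iteratedDeriv k (by norm_cast; simp)
    obtain ⟨r, hr, hr'⟩ := exists_deriv_eq_slope (iteratedDeriv k v) (by linarith : s < t)
      hd.continuous.continuousOn hd.differentiableOn
    refine ⟨r, ⟨by linarith [hr.1, hs.1], by linarith [hr.2, ht.2]⟩, ?_⟩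
    rw [iteratedDeriv_succ, hr', abs_div, abs_of_pos (by linarith : 0 < t - s), pow_succ]
    refine (div_le_self (abs_nonneg _) hst).trans ((abs_sub _ _).trans ?_)
    linarith

theorem exists_abs_iteratedDeriv_le_mul (k i : ℕ) (hi : i ≤ k) :
    ∃ C : ℝ, 0 ≤ C ∧ ∀ v : ℝ → ℝ, ContDiff ℝ k v → ∀ a ε : ℝ, 0 ≤ ε →
      (∀ t ∈ Set.Icc a (a + 3 ^ k), |v t| ≤ ε) →
      (∀ t ∈ Set.Icc a (a + 3 ^ k), |iteratedDeriv k v t| ≤ ε) →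
      ∀ t ∈ Set.Icc a (a + 3 ^ k), |iteratedDeriv (k - i) v t| ≤ C * ε := by
  induction i with
  | zero => exact ⟨1, zero_le_one, fun v _ a ε _ _ h2 t ht => by simpa using h2 t ht⟩
  | succ i ih =>
    obtain ⟨C, hC, h⟩ := ih (by lia)
    refine ⟨2 ^ (k - (i + 1)) + C * 3 ^ k, by positivity, fun v hv a ε hε h1 h2 t ht => ?_⟩
    have h3 := h v hv a ε hε h1 h2
    obtain ⟨j, hj⟩ : ∃ j, j = k - (i + 1) := ⟨_, rfl⟩
    have hj' : k - i = j + 1 := by lia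
    rw [hj'] at h3
    rw [← hj]
    have hpow : (3 : ℝ) ^ j ≤ 3 ^ k := pow_le_pow_right₀ (by norm_num) (by lia)
    have hsub : Set.Icc a (a + 3 ^ j) ⊆ Set.Icc a (a + 3 ^ k) :=
      Set.Icc_subset_Icc_right (by linarith)
    obtain ⟨s, hs, hs'⟩ := exists_abs_iteratedDeriv_le j
      (hv.of_le (by norm_cast; lia)) (a := a) (M := ε) fun t ht => h1 t (hsub ht)
    have hd : Differentiable ℝ (iteratedDeriv j v) :=
      hv.differentiable_iteratedDeriv j (by norm_cast; lia)
    have h4 := (convex_Icc a (a + 3 ^ k)).norm_image_sub_le_of_norm_deriv_le (𝕜 := ℝ)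
      (f := iteratedDeriv j v) (C := C * ε) (fun t _ => hd t)
      (fun t ht => by rw [← iteratedDeriv_succ]; exact h3 t ht) (hsub hs) ht
    have h5 : ‖t - s‖ ≤ 3 ^ k := by
      rw [Real.norm_eq_abs, abs_le]
      constructor <;> linarith [(hsub hs).1, (hsub hs).2, ht.1, ht.2]
    have h6 := h4.trans (mul_le_mul_of_nonneg_left h5 (by positivity))
    rw [Real.norm_eq_abs] at h6
    have h7 := abs_sub_abs_le_abs_sub (iteratedDeriv j v t) (iteratedDeriv j v s)
    linarith

/-! ### Locally uniform limits of smooth functions -/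

/-- The sequence is uniformly Cauchy on every ball. -/
def LocallyUniformCauchy (U : ℕ → E n → ℝ) : Prop :=
  ∀ R : ℝ, UniformCauchySeqOn U Filter.atTop (Metric.closedBall 0 R)

theorem LocallyUniformCauchy.exists_tendsto {U : ℕ → E n → ℝ} (hU : LocallyUniformCauchy U) :
    ∃ u : E n → ℝ, ∀ x, Filter.Tendsto (fun N => U N x) Filter.atTop (𝓝 (u x)) := by
  have : ∀ x, ∃ c, Filter.Tendsto (fun N => U N x) Filter.atTop (𝓝 c) := fun x =>
    cauchySeq_tendsto_of_complete ((hU ‖x‖).cauchySeq (by simp))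
  choose u hu using this
  exact ⟨u, hu⟩

theorem LocallyUniformCauchy.tendstoLocallyUniformlyOn {U : ℕ → E n → ℝ}
    (hU : LocallyUniformCauchy U) {u : E n → ℝ}
    (hu : ∀ x, Filter.Tendsto (fun N => U N x) Filter.atTop (𝓝 (u x))) :
    TendstoLocallyUniformlyOn U u Filter.atTop Set.univ := by
  intro s hs x _
  refine ⟨Metric.closedBall 0 (‖x‖ + 1), mem_nhdsWithin_of_mem_nhds ?_,
    (hU _).tendstoUniformlyOn_of_tendsto (fun y _ => hu y) s hs⟩
  exact Filter.mem_of_superset (Metric.ball_mem_nhds x one_pos) fun y hy => by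
    rw [mem_closedBall_zero_iff]
    rw [Metric.mem_ball, dist_eq_norm] at hy
    linarith [norm_le_norm_add_norm_sub' y x]

theorem iteratedDeriv_comp_basis_line (r : ℕ) (u : E n → ℝ) (i : Fin n) (x : E n) :
    iteratedDeriv r (fun t : ℝ => u (x + t • EuclideanSpace.single i (1 : ℝ))) = fun t =>
      wordDeriv (List.replicate r i) u (x + t • EuclideanSpace.single i (1 : ℝ)) := by
  induction r with
  | zero => funext t; simp
  | succ r ih =>
    rw [iteratedDeriv_succ, ih]
    funext t
    rw [List.replicate_succ, wordDeriv_cons, partialDeriv, lineDeriv]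
    have := deriv_comp_const_add (fun t : ℝ =>
      wordDeriv (List.replicate r i) u (x + t • EuclideanSpace.single i (1 : ℝ))) t 0
    rw [add_zero] at this
    rw [← this]
    simp only [add_smul, add_assoc]

theorem LocallyUniformCauchy.partialDeriv {U : ℕ → E n → ℝ} (hs : ∀ N, ContDiff ℝ ∞ (U N))
    (hU : LocallyUniformCauchy U) (i : Fin n) (k : ℕ)
    (hk : LocallyUniformCauchy fun N => wordDeriv (List.replicate (k + 1) i) (U N)) :
    LocallyUniformCauchy fun N => partialDeriv i (U N) := by
  obtain ⟨C, hC, h⟩ := exists_abs_iteratedDeriv_le_mul (k + 1) k (by lia)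
  intro R
  rw [Metric.uniformCauchySeqOn_iff]
  intro ε hε
  obtain ⟨δ, hδ, hδε⟩ : ∃ δ : ℝ, 0 < δ ∧ C * δ < ε :=
    ⟨ε / (C + 1), by positivity, by
      rw [mul_div_assoc', div_lt_iff₀ (by linarith)]; nlinarith⟩
  obtain ⟨N₁, h₁⟩ := Metric.uniformCauchySeqOn_iff.1 (hU (R + 3 ^ (k + 1))) δ hδ
  obtain ⟨N₂, h₂⟩ := Metric.uniformCauchySeqOn_iff.1 (hk (R + 3 ^ (k + 1))) δ hδ
  refine ⟨max N₁ N₂, fun M hM N hN x hx => lt_of_le_of_lt ?_ hδε⟩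
  set e : E n := EuclideanSpace.single i (1 : ℝ) with he
  have hmem : ∀ t ∈ Set.Icc (0 : ℝ) (0 + 3 ^ (k + 1)),
      x + t • e ∈ Metric.closedBall (0 : E n) (R + 3 ^ (k + 1)) := by
    intro t ht
    rw [mem_closedBall_zero_iff] at hx ⊢
    refine (norm_add_le _ _).trans (add_le_add hx ?_)
    rw [norm_smul, he, PiLp.norm_single, norm_one, mul_one, Real.norm_eq_abs,
      abs_of_nonneg ht.1]
    linarith [ht.2]
  have hline : ∀ (N r : ℕ), ContDiff ℝ r fun t : ℝ => U N (x + t • e) := fun N r =>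
    ((hs N).of_le (by exact_mod_cast le_top)).comp
      (contDiff_const.add (contDiff_id.smul contDiff_const))
  have hsub : ∀ r t, iteratedDeriv r (fun t : ℝ => U M (x + t • e) - U N (x + t • e)) t =
      wordDeriv (List.replicate r i) (U M) (x + t • e) -
        wordDeriv (List.replicate r i) (U N) (x + t • e) := by
    intro r t
    rw [iteratedDeriv_fun_sub (hline M r).contDiffAt (hline N r).contDiffAt,
      iteratedDeriv_comp_basis_line, iteratedDeriv_comp_basis_line]
  have h3 := h (fun t : ℝ => U M (x + t • e) - U N (x + t • e))
    ((hline M _).sub (hline N _)) 0 δ hδ.le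
    (fun t ht => (h₁ M (le_of_max_le_left hM) N (le_of_max_le_left hN) _ (hmem t ht)).le)
    (fun t ht => by
      rw [hsub]
      exact (h₂ M (le_of_max_le_right hM) N (le_of_max_le_right hN) _ (hmem t ht)).le)
    0 ⟨le_rfl, by positivity⟩
  rw [hsub, show k + 1 - k = 1 by lia] at h3
  simpa [Real.dist_eq] using h3

theorem contDiff_infty_partialDeriv {u : E n → ℝ} (hu : ContDiff ℝ ∞ u) (i : Fin n) :
    ContDiff ℝ ∞ (partialDeriv i u) :=
  contDiff_infty.2 fun _ => contDiff_partialDeriv (contDiff_infty.1 hu _) i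

theorem contDiff_of_locallyUniformCauchy (k : ℕ) {U : ℕ → E n → ℝ} {u : E n → ℝ}
    (hs : ∀ N, ContDiff ℝ ∞ (U N)) (hU : LocallyUniformCauchy U)
    (hu : ∀ x, Filter.Tendsto (fun N => U N x) Filter.atTop (𝓝 (u x)))
    (hk : ∀ l : List (Fin n), l.length = k → LocallyUniformCauchy fun N => wordDeriv l (U N)) :
    ContDiff ℝ k u := by
  induction k generalizing U u with
  | zero =>
    refine contDiff_zero.2 (continuousOn_univ.1 ?_)
    exact (hU.tendstoLocallyUniformlyOn hu).continuousOn
      (Filter.Frequently.of_forall fun N => (hs N).continuous.continuousOn)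
  | succ k ih =>
    have h1 : ∀ i, LocallyUniformCauchy fun N => partialDeriv i (U N) := fun i =>
      hU.partialDeriv hs i k (hk _ (by simp))
    choose w hw using fun i => (h1 i).exists_tendsto
    have hwk : ∀ i, ContDiff ℝ k (w i) := by
      intro i
      refine ih (fun N => contDiff_infty_partialDeriv (hs N) i) (h1 i) (hw i) fun l hl => ?_
      have := hk (l ++ [i]) (by simp [hl])
      simpa only [wordDeriv_append, wordDeriv_cons, wordDeriv_nil] using this
    let D : (Fin n → ℝ) →L[ℝ] (E n →L[ℝ] ℝ) :=
      ∑ i, (ContinuousLinearMap.proj (R := ℝ) (φ := fun _ : Fin n => ℝ) i).smulRight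
        (EuclideanSpace.proj (𝕜 := ℝ) i)
    have hD : ∀ a y, D a y = ∑ i, a i * y i := fun a y => by
      simp [D]
    rw [Nat.cast_succ, contDiff_succ_iff_hasFDerivAt]
    refine ⟨fun x => D fun i => w i x, D.contDiff.comp (contDiff_pi.2 hwk), fun x => ?_⟩
    refine hasFDerivAt_of_tendstoLocallyUniformlyOn (l := Filter.atTop) (f := U)
      (f' := fun N x => D fun i => partialDeriv i (U N) x)
      (g' := fun x => D fun i => w i x) isOpen_univ ?_ ?_ (fun x _ => hu x)
      (Set.mem_univ x)
    · have h2 : TendstoLocallyUniformlyOn (fun N x i => partialDeriv i (U N) x)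
          (fun x i => w i x) Filter.atTop Set.univ := by
        rw [Metric.tendstoLocallyUniformlyOn_iff]
        intro ε hε x hx
        have h3 := fun i => Metric.tendstoLocallyUniformlyOn_iff.1
          ((h1 i).tendstoLocallyUniformlyOn (hw i)) ε hε x hx
        choose t ht ht' using h3
        refine ⟨⋂ i, t i, Filter.iInter_mem.2 ht, ?_⟩
        filter_upwards [Filter.eventually_all.2 ht'] with N hN y hy
        rw [dist_pi_lt_iff hε]
        exact fun i => hN i y (Set.mem_iInter.1 hy i)
      exact D.uniformContinuous.comp_tendstoLocallyUniformlyOn h2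
    · intro N x _
      have hd := (hs N).differentiable (by simp)
      convert (hd x).hasFDerivAt using 1
      ext1 y
      rw [hD]
      have hy := congrArg (fderiv ℝ (U N) x) ((EuclideanSpace.basisFun (Fin n) ℝ).sum_repr y)
      rw [← hy, map_sum]
      refine Finset.sum_congr rfl fun i _ => ?_
      rw [partialDeriv_eq_fderiv hd]
      simp [mul_comm]

/-! ### Chains of line derivatives -/

theorem hasDerivAt_comp_line_of_hasLineDerivAt {u v : E n → ℝ} {ξ : E n}
    (h : ∀ x, HasLineDerivAt ℝ u (v x) x ξ) (x : E n) (t : ℝ) :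
    HasDerivAt (fun t : ℝ => u (x + t • ξ)) (v (x + t • ξ)) t := by
  have h1 : HasDerivAt (fun s : ℝ => u (x + t • ξ + s • ξ)) (v (x + t • ξ)) (t - t) := by
    rw [sub_self]
    exact h (x + t • ξ)
  have h2 := h1.comp_sub_const t t
  refine h2.congr_of_eventuallyEq (Filter.Eventually.of_forall fun s => ?_)
  simp only [add_assoc, ← add_smul]
  congr 3
  ring

theorem iteratedDeriv_comp_line_of_hasLineDerivAt {v : ℕ → E n → ℝ} {ξ : E n}
    (h : ∀ j < k, ∀ x, HasLineDerivAt ℝ (v j) (v (j + 1) x) x ξ) {j : ℕ} (hj : j ≤ k) (x : E n) :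
    iteratedDeriv j (fun t : ℝ => v 0 (x + t • ξ)) = fun t => v j (x + t • ξ) := by
  induction j with
  | zero => simp
  | succ j ih =>
    rw [iteratedDeriv_succ, ih (by lia)]
    funext t
    exact (hasDerivAt_comp_line_of_hasLineDerivAt (h j (by lia)) x t).deriv

theorem dirDeriv_of_hasLineDerivAt {v : ℕ → E n → ℝ} {ξ : E n}
    (h : ∀ j < k, ∀ x, HasLineDerivAt ℝ (v j) (v (j + 1) x) x ξ) {j : ℕ} (hj : j ≤ k) :
    dirDeriv j ξ (v 0) = v j := by
  funext x
  rw [dirDeriv, iteratedDeriv_comp_line_of_hasLineDerivAt h hj]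
  simp

theorem isDirCk_of_hasLineDerivAt {v : ℕ → E n → ℝ} {ξ : E n}
    (h : ∀ j < k, ∀ x, HasLineDerivAt ℝ (v j) (v (j + 1) x) x ξ)
    (hc : ∀ j ≤ k, Continuous (v j)) : IsDirCk k ξ (v 0) := by
  refine ⟨hc 0 (Nat.zero_le k), fun x j hj => ?_, fun j _ hj => ?_⟩
  · rw [iteratedDeriv_comp_line_of_hasLineDerivAt h hj.le]
    exact fun t => (hasDerivAt_comp_line_of_hasLineDerivAt (h j hj) x t).differentiableAt
  · rw [dirDeriv_of_hasLineDerivAt h hj]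
    exact hc j hj

theorem dirDeriv_zero (ξ : E n) (u : E n → ℝ) : dirDeriv 0 ξ u = u := by
  funext x
  simp [dirDeriv]

theorem IsDirCk.hasLineDerivAt {ξ : E n} {u : E n → ℝ} (hu : IsDirCk k ξ u) {j : ℕ} (hj : j < k)
    (x : E n) : HasLineDerivAt ℝ (dirDeriv j ξ u) (dirDeriv (j + 1) ξ u x) x ξ := by
  have h1 := (hu.2.1 x j hj 0).hasDerivAt
  rw [← iteratedDeriv_succ] at h1
  have h2 : iteratedDeriv j (fun t : ℝ => u (x + t • ξ)) =
      fun t => dirDeriv j ξ u (x + t • ξ) :=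
    funext fun t => iteratedDeriv_comp_line_eq_dirDeriv j u ξ x t
  rw [h2] at h1
  exact h1

theorem IsDirCk.continuous_dirDeriv {ξ : E n} {u : E n → ℝ} (hu : IsDirCk k ξ u) {j : ℕ}
    (hj : j ≤ k) : Continuous (dirDeriv j ξ u) := by
  rcases Nat.eq_zero_or_pos j with rfl | h
  · rw [dirDeriv_zero]
    exact hu.1
  · exact hu.2.2 j h hj

/-! ### Mollification -/

/-- The convolution of `g` with the normalised bump function `φ`. -/
noncomputable def mollify (φ : ContDiffBump (0 : E n)) (g : E n → ℝ) (x : E n) : ℝ :=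
  ∫ y, φ.normed volume y * g (x - y)

theorem mollify_eq_convolution (φ : ContDiffBump (0 : E n)) (g : E n → ℝ) :
    mollify φ g = convolution (φ.normed volume) g (ContinuousLinearMap.lsmul ℝ ℝ) volume := by
  funext x
  simp [mollify, convolution]

theorem contDiff_mollify (φ : ContDiffBump (0 : E n)) {g : E n → ℝ} (hg : Continuous g) :
    ContDiff ℝ ∞ (mollify φ g) := by
  rw [mollify_eq_convolution]
  exact φ.hasCompactSupport_normed.contDiff_convolution_left _ φ.contDiff_normed
    hg.locallyIntegrable

theorem integrable_mollifier_mul (φ : ContDiffBump (0 : E n)) {g : E n → ℝ} (hg : Continuous g)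
    (x : E n) : Integrable (fun y => φ.normed volume y * g (x - y)) volume :=
  ((φ.continuous_normed (μ := volume)).mul
    (hg.comp (continuous_const.sub continuous_id))).integrable_of_hasCompactSupport
    φ.hasCompactSupport_normed.mul_right

theorem mollify_sum {ι : Type*} (s : Finset ι) (φ : ContDiffBump (0 : E n)) (c : ι → ℝ)
    {g : ι → E n → ℝ} (hg : ∀ i, Continuous (g i)) :
    mollify φ (fun x => ∑ i ∈ s, c i * g i x) = fun x => ∑ i ∈ s, c i * mollify φ (g i) x := by
  funext x
  simp only [mollify]
  rw [← Finset.sum_congr rfl fun i _ => integral_const_mul (c i) _,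
    ← integral_finsetSum _ fun i _ => (integrable_mollifier_mul φ (hg i) x).const_mul (c i)]
  congr 1
  funext y
  rw [Finset.mul_sum]
  refine Finset.sum_congr rfl fun i _ => ?_
  ring

theorem hasLineDerivAt_mollify (φ : ContDiffBump (0 : E n)) {g g' : E n → ℝ} (hg : Continuous g)
    (hg' : Continuous g') {ξ : E n} (h : ∀ x, HasLineDerivAt ℝ g (g' x) x ξ) (x : E n) :
    HasLineDerivAt ℝ (mollify φ g) (mollify φ g' x) x ξ := by
  obtain ⟨C, hC⟩ := (isCompact_closedBall x (‖ξ‖ + φ.rOut)).exists_bound_of_continuousOn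
    hg'.continuousOn
  have hkey := hasDerivAt_integral_of_dominated_loc_of_deriv_le (μ := (volume : Measure (E n)))
    (F := fun (t : ℝ) y => φ.normed volume y * g (x + t • ξ - y))
    (F' := fun (t : ℝ) y => φ.normed volume y * g' (x + t • ξ - y)) (x₀ := 0)
    (bound := fun y => φ.normed volume y * C) (Metric.ball_mem_nhds 0 one_pos)
    (Filter.Eventually.of_forall fun t =>
      (integrable_mollifier_mul φ hg (x + t • ξ)).aestronglyMeasurable)
    (integrable_mollifier_mul φ hg _)
    (integrable_mollifier_mul φ hg' _).aestronglyMeasurable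
    (Filter.Eventually.of_forall fun y t ht => ?_)
    (φ.integrable_normed.mul_const C)
    (Filter.Eventually.of_forall fun y t _ => ?_)
  · have := hkey.2
    simp only [zero_smul, add_zero] at this
    exact this
  · rw [norm_mul, Real.norm_of_nonneg (φ.nonneg_normed y)]
    by_cases hy : y ∈ Function.support (φ.normed volume)
    · refine mul_le_mul_of_nonneg_left (hC _ ?_) (φ.nonneg_normed y)
      rw [φ.support_normed_eq, mem_ball_zero_iff] at hy
      rw [mem_ball_zero_iff, Real.norm_eq_abs] at ht
      rw [Metric.mem_closedBall, dist_eq_norm]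
      calc ‖x + t • ξ - y - x‖ = ‖t • ξ - y‖ := by congr 1; abel
        _ ≤ ‖t • ξ‖ + ‖y‖ := norm_sub_le _ _
        _ ≤ ‖ξ‖ + φ.rOut := by
          rw [norm_smul, Real.norm_eq_abs]
          nlinarith [norm_nonneg ξ]
    · rw [Function.notMem_support.1 hy, zero_mul, zero_mul]
  · have := (hasDerivAt_comp_line_of_hasLineDerivAt h (x - y) t).const_mul (φ.normed volume y)
    simpa only [sub_add_eq_add_sub] using this

theorem IsDirCk.dirDeriv_mollify {ξ : E n} {u : E n → ℝ} (hu : IsDirCk k ξ u)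
    (φ : ContDiffBump (0 : E n)) :
    dirDeriv k ξ (mollify φ u) = mollify φ (dirDeriv k ξ u) := by
  have := dirDeriv_of_hasLineDerivAt (k := k) (v := fun j => mollify φ (dirDeriv j ξ u)) (ξ := ξ)
    (fun j hj => hasLineDerivAt_mollify φ (hu.continuous_dirDeriv hj.le)
      (hu.continuous_dirDeriv hj) fun x => hu.hasLineDerivAt hj x) le_rfl
  rwa [dirDeriv_zero] at this

/-- A sequence of bump functions concentrating at the origin. -/
noncomputable def bumpSeq (n N : ℕ) : ContDiffBump (0 : E n) :=
  ⟨1 / (N + 1), 2 / (N + 1), by positivity, by gcongr; norm_num⟩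

theorem tendstoUniformlyOn_mollify {g : E n → ℝ} (hg : Continuous g) (R : ℝ) :
    TendstoUniformlyOn (fun N => mollify (bumpSeq n N) g) g Filter.atTop
      (Metric.closedBall 0 R) := by
  rw [Metric.tendstoUniformlyOn_iff]
  intro ε hε
  have hu := (isCompact_closedBall (0 : E n) (R + 2)).uniformContinuousOn_of_continuous
    hg.continuousOn
  obtain ⟨δ, hδ, h⟩ := Metric.uniformContinuousOn_iff.1 hu (ε / 2) (by positivity)
  have hlim : Filter.Tendsto (fun N : ℕ => (2 : ℝ) / (N + 1)) Filter.atTop (𝓝 0) :=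
    tendsto_const_div_atTop_nhds_zero_nat 2 |>.comp (Filter.tendsto_add_atTop_nat 1) |>.congr
      fun N => by simp
  filter_upwards [hlim.eventually_lt_const hδ, hlim.eventually_lt_const two_pos] with N h1 h2 x hx
  rw [mollify_eq_convolution, dist_comm]
  refine lt_of_le_of_lt (ContDiffBump.dist_normed_convolution_le hg.aestronglyMeasurable
    fun y hy => ?_) (half_lt_self hε)
  have hy' : dist y x < 2 / (N + 1) := hy
  rw [mem_closedBall_zero_iff] at hx
  refine (h y ?_ x ?_ (hy'.trans h1)).le
  · rw [mem_closedBall_zero_iff]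
    rw [dist_eq_norm] at hy'
    linarith [norm_le_norm_add_norm_sub' y x]
  · rw [mem_closedBall_zero_iff]
    linarith

theorem locallyUniformCauchy_mollify {g : E n → ℝ} (hg : Continuous g) :
    LocallyUniformCauchy fun N => mollify (bumpSeq n N) g :=
  fun R => (tendstoUniformlyOn_mollify hg R).uniformCauchySeqOn

/-! ### Partial regularity forces regularity -/

theorem continuous_of_continuous_pairing {Λ : Set (E n × E m)} (hn : 0 < n)
    (h : HasNonsingularPoints k Λ) {f : E n → E m}
    (hf : ∀ p ∈ Λ, Continuous (pairing f p.2)) (j : Fin m) : Continuous fun x => f x j := by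
  obtain ⟨P, hP, A, hA⟩ := exists_dual_coefficients h
  let α : MultiIndex n k := ⟨Pi.single ⟨0, hn⟩ k, by
    rw [Finset.sum_pi_single']
    simp⟩
  have h1 : (fun x => f x j) =
      fun x => ∑ p, A α j p * (monomial α (P p).1 * pairing f (P p).2 x) := by
    funext x
    have h2 := dual_coefficients_apply hA (fun β i => if β = α then f x i else 0) α j
    rw [if_pos rfl] at h2
    rw [← h2]
    refine Finset.sum_congr rfl fun p _ => ?_
    congr 1
    rw [pairing_eq_sum, Finset.mul_sum]
    refine Finset.sum_congr rfl fun i _ => ?_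
    simp only [mul_ite, mul_zero, Finset.sum_ite_eq', Finset.mem_univ, if_true]
    ring
  rw [h1]
  exact continuous_finsetSum _ fun p _ =>
    continuous_const.mul (continuous_const.mul (hf _ (hP p)))

theorem forcesCk_of_hasNonsingularPoints {Λ : Set (E n × E m)} (h : HasNonsingularPoints k Λ) :
    ForcesCk k Λ := by
  intro f _ hf
  rcases Nat.eq_zero_or_pos n with rfl | hn
  · rw [show f = fun _ => f 0 from funext fun x => congrArg f (Subsingleton.elim x 0)]
    exact contDiff_const
  have hfc := continuous_of_continuous_pairing hn h fun p hp => (hf p hp).1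
  obtain ⟨P, hP, A, hA⟩ := exists_dual_coefficients h
  let F : ℕ → E n → E m := fun N x => WithLp.toLp 2 fun j =>
    mollify (bumpSeq n N) (fun y => f y j) x
  have hF : ∀ N, ContDiff ℝ k (F N) := fun N => contDiff_euclidean.2 fun j =>
    (contDiff_mollify _ (hfc j)).of_le (by exact_mod_cast le_top)
  have hpair : ∀ N η, pairing (F N) η = mollify (bumpSeq n N) (pairing f η) := by
    intro N η
    rw [pairing_eq_sum, pairing_eq_sum, mollify_sum _ _ _ hfc]
  refine contDiff_euclidean.2 fun j => ?_
  refine contDiff_of_locallyUniformCauchy k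
    (U := fun N => mollify (bumpSeq n N) fun y => f y j)
    (fun N => contDiff_mollify _ (hfc j)) (locallyUniformCauchy_mollify (hfc j))
    (fun x => (tendstoUniformlyOn_mollify (hfc j) ‖x‖).tendsto_at (by simp)) ?_
  rintro l rfl
  obtain ⟨α, hα⟩ : ∃ α, α = contentOf l.get := ⟨_, rfl⟩
  have h1 : ∀ N, wordDeriv l (mollify (bumpSeq n N) fun y => f y j) =
      mollify (bumpSeq n N) fun x => ∑ p, (wordCount α : ℝ)⁻¹ * A α j p *
        dirDeriv l.length (P p).1 (pairing f (P p).2) x := by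
    intro N
    have h2 := wordDeriv_ofFn l.get (contDiff_apply_coord (hF N) j)
    rw [List.ofFn_get, ← hα] at h2
    refine h2.trans ?_
    rw [mollify_sum _ _ _ fun p => (hf _ (hP p)).continuous_dirDeriv le_rfl]
    funext x
    rw [multiDeriv_eq_sum_dirDeriv hA (hF N)]
    refine Finset.sum_congr rfl fun p _ => ?_
    rw [hpair, (hf _ (hP p)).dirDeriv_mollify]
  simp only [h1]
  exact locallyUniformCauchy_mollify (continuous_finsetSum _ fun p _ =>
    continuous_const.mul ((hf _ (hP p)).continuous_dirDeriv le_rfl))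

/-! ### Homogeneous functions -/

theorem dirDeriv_congr {u v : E n → ℝ} {x : E n} (h : u =ᶠ[𝓝 x] v) (j : ℕ) (ξ : E n) :
    dirDeriv j ξ u x = dirDeriv j ξ v x := by
  have hc : Filter.Tendsto (fun t : ℝ => x + t • ξ) (𝓝 0) (𝓝 x) := by
    have : Continuous fun t : ℝ => x + t • ξ := by fun_prop
    simpa using this.tendsto 0
  exact Filter.EventuallyEq.iteratedDeriv_eq j (hc.eventually h)

theorem contDiff_line {u : E n → ℝ} {r : ℕ} (hu : ContDiff ℝ r u) (x ξ : E n) :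
    ContDiff ℝ r fun t : ℝ => u (x + t • ξ) :=
  hu.comp (contDiff_const.add (contDiff_id.smul contDiff_const))

theorem isDirCk_of_contDiff {u : E n → ℝ} (hu : ContDiff ℝ k u) (ξ : E n) : IsDirCk k ξ u :=
  ⟨hu.continuous, fun x j hj => (contDiff_line hu x ξ).differentiable_iteratedDeriv j
    (by exact_mod_cast hj), fun j _ hj => continuous_dirDeriv (hu.of_le (by exact_mod_cast hj)) ξ⟩

theorem dirDeriv_const_mul {u : E n → ℝ} (hu : ContDiff ℝ k u) (c : ℝ) (ξ x : E n) :
    dirDeriv k ξ (fun y => c * u y) x = c * dirDeriv k ξ u x :=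
  iteratedDeriv_const_mul c (contDiff_line hu x ξ).contDiffAt

theorem dirDeriv_of_homogeneous {Q : E n → ℝ} (hQ : ContDiff ℝ k Q)
    (hhom : ∀ (s : ℝ) x, Q (s • x) = s ^ k * Q x) (ξ x : E n) :
    dirDeriv k ξ Q x = k.factorial * Q ξ := by
  have h0 : dirDeriv k ξ Q 0 = k.factorial * Q ξ := by
    rw [dirDeriv]
    simp only [zero_add, hhom]
    have : (fun t : ℝ => t ^ k * Q ξ) = fun t => Q ξ * t ^ k := funext fun t => mul_comm _ _
    rw [this, iteratedDeriv_const_mul _ (contDiff_id.pow k).contDiffAt]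
    simp [Nat.descFactorial_self, mul_comm]
  have hscale : ∀ s : ℝ, s ≠ 0 → dirDeriv k ξ Q (s • x) = dirDeriv k ξ Q x := by
    intro s hs
    have h1 : (fun t : ℝ => Q (s • x + t • ξ)) = fun t => s ^ k * Q (x + (s⁻¹ * t) • ξ) := by
      funext t
      rw [← hhom, smul_add, smul_smul, mul_inv_cancel_left₀ hs]
    have h2 := contDiff_line hQ x ξ
    have h3 : ContDiff ℝ k fun t : ℝ => Q (x + (s⁻¹ * t) • ξ) :=
      h2.comp (contDiff_const.mul contDiff_id)
    rw [dirDeriv, h1, iteratedDeriv_const_mul _ h3.contDiffAt,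
      iteratedDeriv_comp_const_mul h2 s⁻¹]
    simp only [mul_zero]
    rw [← mul_assoc, ← mul_pow, mul_inv_cancel₀ hs, one_pow, one_mul]
    rfl
  have hc : Continuous fun s : ℝ => dirDeriv k ξ Q (s • x) :=
    (continuous_dirDeriv hQ ξ).comp (continuous_id.smul continuous_const)
  have hlim : Filter.Tendsto (fun s : ℝ => dirDeriv k ξ Q (s • x)) (𝓝[≠] 0)
      (𝓝 (dirDeriv k ξ Q 0)) := by
    simpa using (hc.tendsto 0).mono_left nhdsWithin_le_nhds
  have hlim' : Filter.Tendsto (fun s : ℝ => dirDeriv k ξ Q (s • x)) (𝓝[≠] 0)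
      (𝓝 (dirDeriv k ξ Q x)) :=
    tendsto_const_nhds.congr' (by
      filter_upwards [self_mem_nhdsWithin] with s hs
      exact (hscale s hs).symm)
  rw [tendsto_nhds_unique hlim' hlim, h0]

/-! ### A function with a slowly growing factor -/

/-- A smooth cut-off function, equal to `1` on the unit ball and to `0` off the ball of
radius `2`. -/
noncomputable def cutoff (n : ℕ) : ContDiffBump (0 : E n) := ⟨1, 2, one_pos, one_lt_two⟩

/-- A function that is smooth off the origin and grows like `log log (1 / |x|)` there. -/
noncomputable def slowGrowth (x : E n) : ℝ :=
  ∑' i : ℕ, 1 / ((i : ℝ) + 1) * cutoff n ((4 : ℝ) ^ i • x)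

theorem cutoff_eventuallyEq_one {x : E n} (hx : ‖x‖ < 1) : ∀ᶠ y in 𝓝 x, cutoff n y = 1 := by
  filter_upwards [continuous_norm.continuousAt.eventually_lt_const hx] with y hy
  exact (cutoff n).one_of_mem_closedBall (by simpa [cutoff] using hy.le)

theorem cutoff_eventuallyEq_zero {x : E n} (hx : 2 < ‖x‖) : ∀ᶠ y in 𝓝 x, cutoff n y = 0 := by
  filter_upwards [continuous_norm.continuousAt.eventually_const_lt hx] with y hy
  exact (cutoff n).zero_of_le_dist (by simpa [cutoff] using hy.le)

theorem slowGrowth_eventuallyEq {N : ℕ} {x : E n} (h1 : 4 ^ N * ‖x‖ < 1)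
    (h2 : 2 < 4 ^ (N + 1) * ‖x‖) :
    ∀ᶠ y in 𝓝 x, slowGrowth y = ∑ i ∈ Finset.range (N + 1), 1 / ((i : ℝ) + 1) := by
  have hc : Continuous fun y : E n => ‖y‖ := continuous_norm
  filter_upwards [(continuous_const.mul hc).continuousAt.eventually_lt_const h1,
    (continuous_const.mul hc).continuousAt.eventually_const_lt h2] with y hy1 hy2
  have hnorm : ∀ i : ℕ, ‖(4 : ℝ) ^ i • y‖ = 4 ^ i * ‖y‖ := fun i => by
    rw [norm_smul, norm_pow, Real.norm_ofNat]
  rw [slowGrowth, tsum_eq_sum (s := Finset.range (N + 1))]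
  · refine Finset.sum_congr rfl fun i hi => ?_
    rw [(cutoff_eventuallyEq_one (x := (4 : ℝ) ^ i • y) ?_).self_of_nhds, mul_one]
    rw [hnorm]
    refine lt_of_le_of_lt (mul_le_mul_of_nonneg_right ?_ (norm_nonneg y)) hy1
    exact pow_le_pow_right₀ (by norm_num) (Nat.lt_succ_iff.1 (Finset.mem_range.1 hi))
  · intro i hi
    rw [(cutoff_eventuallyEq_zero (x := (4 : ℝ) ^ i • y) ?_).self_of_nhds, mul_zero]
    rw [hnorm]
    refine hy2.trans_le (mul_le_mul_of_nonneg_right ?_ (norm_nonneg y))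
    exact pow_le_pow_right₀ (by norm_num) (by simpa using hi)

theorem contDiff_mul_cutoff {Q : E n → ℝ} (hQ : ContDiff ℝ ∞ Q) :
    ContDiff ℝ ∞ fun x => Q x * cutoff n x :=
  hQ.mul (cutoff n).contDiff

theorem dirDeriv_mul_cutoff_of_two_lt {Q : E n → ℝ} (hQ : ContDiff ℝ ∞ Q) (j : ℕ) (ξ : E n)
    {x : E n} (hx : 2 < ‖x‖) : dirDeriv j ξ (fun x => Q x * cutoff n x) x = 0 := by
  rw [dirDeriv_congr (v := fun y => 0 * Q y) (by
    filter_upwards [cutoff_eventuallyEq_zero hx] with y hy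
    rw [hy, mul_zero, zero_mul]), dirDeriv_const_mul (contDiff_infty.1 hQ j), zero_mul]

theorem dirDeriv_mul_cutoff_of_lt_one {Q : E n → ℝ} (hQ : ContDiff ℝ ∞ Q)
    (hhom : ∀ (s : ℝ) x, Q (s • x) = s ^ k * Q x) {ξ : E n} (hξ : Q ξ = 0) {x : E n}
    (hx : ‖x‖ < 1) : dirDeriv k ξ (fun x => Q x * cutoff n x) x = 0 := by
  rw [dirDeriv_congr (v := Q) (by
    filter_upwards [cutoff_eventuallyEq_one hx] with y hy
    rw [hy, mul_one]), dirDeriv_of_homogeneous (contDiff_infty.1 hQ k) hhom, hξ, mul_zero]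

theorem exists_bound_dirDeriv_mul_cutoff {Q : E n → ℝ} (hQ : ContDiff ℝ ∞ Q) (j : ℕ) (ξ : E n) :
    ∃ C, ∀ x, ‖dirDeriv j ξ (fun x => Q x * cutoff n x) x‖ ≤ C := by
  refine (continuous_dirDeriv (contDiff_infty.1 (contDiff_mul_cutoff hQ) j)
    ξ).bounded_above_of_compact_support
    (HasCompactSupport.intro (isCompact_closedBall 0 2) fun x hx => ?_)
  refine dirDeriv_mul_cutoff_of_two_lt hQ j ξ ?_
  simpa using hx

/-- The terms of the series for the `j`-th derivative of `Q * slowGrowth` along `ξ`. -/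
noncomputable def derivTerm (k : ℕ) (Q : E n → ℝ) (ξ : E n) (j i : ℕ) (x : E n) : ℝ :=
  1 / ((i : ℝ) + 1) * ((4 : ℝ) ^ i)⁻¹ ^ (k - j) *
    dirDeriv j ξ (fun y => Q y * cutoff n y) ((4 : ℝ) ^ i • x)

theorem hasLineDerivAt_derivTerm {Q : E n → ℝ} (hQ : ContDiff ℝ ∞ Q) (ξ : E n) {j : ℕ}
    (hj : j < k) (i : ℕ) (x : E n) :
    HasLineDerivAt ℝ (derivTerm k Q ξ j i) (derivTerm k Q ξ (j + 1) i x) x ξ := by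
  have h1 := fun y => (isDirCk_of_contDiff (contDiff_infty.1 (contDiff_mul_cutoff hQ) k)
    ξ).hasLineDerivAt hj y
  have h2 := hasDerivAt_comp_line_of_hasLineDerivAt h1 ((4 : ℝ) ^ i • x) ((4 : ℝ) ^ i * 0)
  have h3 := (h2.comp (0 : ℝ) ((hasDerivAt_id (0 : ℝ)).const_mul ((4 : ℝ) ^ i))).const_mul
    (1 / ((i : ℝ) + 1) * ((4 : ℝ) ^ i)⁻¹ ^ (k - j))
  refine (h3.congr_deriv ?_).congr_of_eventuallyEq (Filter.Eventually.of_forall fun t => ?_)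
  · have h4 : k - j = k - (j + 1) + 1 := by lia
    have h5 : ((4 : ℝ) ^ i)⁻¹ * 4 ^ i = 1 := inv_mul_cancel₀ (by positivity)
    rw [derivTerm, h4, pow_succ]
    simp only [mul_zero, zero_smul, add_zero, mul_one]
    linear_combination (1 / ((i : ℝ) + 1) * ((4 : ℝ) ^ i)⁻¹ ^ (k - (j + 1)) *
      dirDeriv (j + 1) ξ (fun y => Q y * cutoff n y) ((4 : ℝ) ^ i • x)) * h5
  · simp [derivTerm, smul_add, smul_smul]

theorem continuous_derivTerm {Q : E n → ℝ} (hQ : ContDiff ℝ ∞ Q) (ξ : E n) (j i : ℕ) :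
    Continuous (derivTerm k Q ξ j i) :=
  continuous_const.mul ((continuous_dirDeriv (contDiff_infty.1 (contDiff_mul_cutoff hQ) j) ξ).comp
    (continuous_const_smul _))

theorem norm_derivTerm_le {Q : E n → ℝ} {ξ : E n} {j : ℕ} {C : ℝ}
    (hC : ∀ x, ‖dirDeriv j ξ (fun x => Q x * cutoff n x) x‖ ≤ C) (i : ℕ) (x : E n) :
    ‖derivTerm k Q ξ j i x‖ ≤ 1 / ((i : ℝ) + 1) * ((4 : ℝ) ^ i)⁻¹ ^ (k - j) * C := by
  rw [derivTerm, norm_mul, Real.norm_of_nonneg (by positivity)]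
  exact mul_le_mul_of_nonneg_left (hC _) (by positivity)

theorem tendstoUniformly_derivTerm_of_lt {Q : E n → ℝ} (hQ : ContDiff ℝ ∞ Q) (ξ : E n) {j : ℕ}
    (hj : j < k) :
    TendstoUniformly (fun N x => ∑ i ∈ Finset.range N, derivTerm k Q ξ j i x)
      (fun x => ∑' i, derivTerm k Q ξ j i x) Filter.atTop := by
  obtain ⟨C, hC⟩ := exists_bound_dirDeriv_mul_cutoff hQ j ξ
  have hC0 : 0 ≤ C := (norm_nonneg _).trans (hC 0)
  refine tendstoUniformly_tsum_nat (u := fun i => (4 : ℝ)⁻¹ ^ i * C)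
    ((summable_geometric_of_lt_one (by norm_num) (by norm_num)).mul_right C) fun i x => ?_
  refine (norm_derivTerm_le hC i x).trans (mul_le_mul_of_nonneg_right ?_ hC0)
  have h1 : 1 / ((i : ℝ) + 1) ≤ 1 := by
    rw [div_le_one (by positivity)]
    linarith [(Nat.cast_nonneg i : (0 : ℝ) ≤ i)]
  have h2 : ((4 : ℝ) ^ i)⁻¹ ^ (k - j) ≤ (4 : ℝ)⁻¹ ^ i := by
    rw [inv_pow (4 : ℝ) i]
    exact pow_le_of_le_one (by positivity) (inv_le_one_of_one_le₀ (one_le_pow₀ (by norm_num)))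
      (by lia)
  calc 1 / ((i : ℝ) + 1) * ((4 : ℝ) ^ i)⁻¹ ^ (k - j)
      ≤ 1 * (4 : ℝ)⁻¹ ^ i := mul_le_mul h1 h2 (by positivity) zero_le_one
    _ = (4 : ℝ)⁻¹ ^ i := one_mul _

theorem derivTerm_eq_zero_of_ne {Q : E n → ℝ} (hQ : ContDiff ℝ ∞ Q)
    (hhom : ∀ (s : ℝ) x, Q (s • x) = s ^ k * Q x) {ξ : E n} (hξ : Q ξ = 0) {i i' : ℕ}
    (hne : i' ≠ i) {x : E n} (hi : derivTerm k Q ξ k i x ≠ 0) : derivTerm k Q ξ k i' x = 0 := by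
  have hnorm : ∀ i : ℕ, ‖(4 : ℝ) ^ i • x‖ = 4 ^ i * ‖x‖ := fun i => by
    rw [norm_smul, norm_pow, Real.norm_ofNat]
  have hbounds : ∀ i : ℕ, derivTerm k Q ξ k i x ≠ 0 → 1 ≤ 4 ^ i * ‖x‖ ∧ 4 ^ i * ‖x‖ ≤ 2 := by
    intro i hi
    rw [← hnorm]
    constructor
    · by_contra! h
      exact hi (by rw [derivTerm, dirDeriv_mul_cutoff_of_lt_one hQ hhom hξ h, mul_zero])
    · by_contra! h
      exact hi (by rw [derivTerm, dirDeriv_mul_cutoff_of_two_lt hQ k ξ h, mul_zero])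
  have hlt : ∀ a b : ℕ, a < b → 1 ≤ 4 ^ a * ‖x‖ → 4 ^ b * ‖x‖ ≤ 2 → False := by
    intro a b hab h1 h2
    have h3 : (4 : ℝ) ^ (a + 1) ≤ 4 ^ b := pow_le_pow_right₀ (by norm_num) hab
    have h4 := mul_le_mul_of_nonneg_right h3 (norm_nonneg x)
    rw [pow_succ] at h4
    linarith
  by_contra hi'
  rcases lt_or_gt_of_ne hne with h | h
  · exact hlt _ _ h (hbounds _ hi').1 (hbounds _ hi).2
  · exact hlt _ _ h (hbounds _ hi).1 (hbounds _ hi').2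

theorem tendstoUniformly_derivTerm {Q : E n → ℝ} (hQ : ContDiff ℝ ∞ Q)
    (hhom : ∀ (s : ℝ) x, Q (s • x) = s ^ k * Q x) {ξ : E n} (hξ : Q ξ = 0) {j : ℕ}
    (hj : j ≤ k) :
    TendstoUniformly (fun N x => ∑ i ∈ Finset.range N, derivTerm k Q ξ j i x)
      (fun x => ∑' i, derivTerm k Q ξ j i x) Filter.atTop := by
  rcases hj.lt_or_eq with hj | rfl
  · exact tendstoUniformly_derivTerm_of_lt hQ ξ hj
  obtain ⟨C, hC⟩ := exists_bound_dirDeriv_mul_cutoff hQ j ξ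
  have hC0 : 0 ≤ C := (norm_nonneg _).trans (hC 0)
  rw [Metric.tendstoUniformly_iff]
  intro ε hε
  have hlim : Filter.Tendsto (fun N : ℕ => 1 / ((N : ℝ) + 1) * C) Filter.atTop (𝓝 0) := by
    simpa using tendsto_one_div_add_atTop_nhds_zero_nat.mul_const C
  filter_upwards [hlim.eventually_lt_const hε] with N hN x
  by_cases hx : ∀ i, derivTerm j Q ξ j i x = 0
  · simpa [hx] using hε
  obtain ⟨i, hi⟩ := not_forall.1 hx
  have hzero := fun i' (h : i' ≠ i) => derivTerm_eq_zero_of_ne hQ hhom hξ h hi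
  rw [tsum_eq_single i hzero]
  by_cases hiN : i ∈ Finset.range N
  · rw [Finset.sum_eq_single_of_mem i hiN fun i' _ h => hzero i' h, dist_self]
    exact hε
  · rw [Finset.sum_eq_zero fun i' hi' => hzero i' fun h => hiN (h ▸ hi'), dist_zero_right]
    refine lt_of_le_of_lt ((norm_derivTerm_le hC i x).trans ?_) hN
    rw [Nat.sub_self, pow_zero, mul_one]
    refine mul_le_mul_of_nonneg_right (one_div_le_one_div_of_le (by positivity) ?_) hC0
    have : N ≤ i := by simpa using hiN
    gcongr

theorem mul_slowGrowth_eq_tsum {Q : E n → ℝ} (hhom : ∀ (s : ℝ) x, Q (s • x) = s ^ k * Q x)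
    (ξ : E n) : (fun x => Q x * slowGrowth x) = fun x => ∑' i, derivTerm k Q ξ 0 i x := by
  funext x
  rw [slowGrowth, ← tsum_mul_left]
  congr 1
  funext i
  rw [derivTerm, dirDeriv_zero, hhom, Nat.sub_zero, inv_pow]
  have : ((4 : ℝ) ^ i) ^ k ≠ 0 := by positivity
  field_simp

theorem isDirCk_mul_slowGrowth {Q : E n → ℝ} (hQ : ContDiff ℝ ∞ Q)
    (hhom : ∀ (s : ℝ) x, Q (s • x) = s ^ k * Q x) {ξ : E n} (hξ : Q ξ = 0) :
    IsDirCk k ξ fun x => Q x * slowGrowth x := by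
  rw [mul_slowGrowth_eq_tsum hhom ξ]
  refine isDirCk_of_hasLineDerivAt (v := fun j x => ∑' i, derivTerm k Q ξ j i x)
    (fun j hj x => ?_) fun j hj => ?_
  · have hu := fun {j} (hj : j ≤ k) => tendstoUniformly_derivTerm hQ hhom hξ hj
    have h1 := hasDerivAt_of_tendstoUniformly (l := Filter.atTop)
      (f := fun N t => ∑ i ∈ Finset.range N, derivTerm k Q ξ j i (x + t • ξ))
      (g := fun t => ∑' i, derivTerm k Q ξ j i (x + t • ξ))
      (f' := fun N t => ∑ i ∈ Finset.range N, derivTerm k Q ξ (j + 1) i (x + t • ξ))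
      (g' := fun t => ∑' i, derivTerm k Q ξ (j + 1) i (x + t • ξ))
      ((hu hj).comp fun t : ℝ => x + t • ξ)
      (Filter.Eventually.of_forall fun N t => HasDerivAt.fun_sum fun i _ =>
        hasDerivAt_comp_line_of_hasLineDerivAt
          (fun y => hasLineDerivAt_derivTerm hQ ξ hj i y) x t)
      (fun t => (hu hj.le).tendsto_at (x + t • ξ)) 0
    simpa [HasLineDerivAt] using h1
  · exact (tendstoUniformly_derivTerm hQ hhom hξ hj).continuous
      (Filter.Frequently.of_forall fun N =>
        continuous_finsetSum _ fun i _ => continuous_derivTerm hQ ξ j i)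

theorem not_contDiff_mul_slowGrowth {Q : E n → ℝ} (hQ : ContDiff ℝ ∞ Q) (hk : 1 ≤ k)
    (hhom : ∀ (s : ℝ) x, Q (s • x) = s ^ k * Q x) {ξ : E n} (hξ : Q ξ ≠ 0) :
    ¬ ContDiff ℝ k fun x => Q x * slowGrowth x := by
  intro hcd
  have hξ0 : 0 < ‖ξ‖ := norm_pos_iff.2 fun h => hξ (by
    have := hhom 0 ξ
    rw [zero_smul, zero_pow (by lia), zero_mul] at this
    rwa [h])
  obtain ⟨C, hC⟩ := (isCompact_closedBall (0 : E n) 1).exists_bound_of_continuousOn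
    (continuous_dirDeriv hcd ξ).continuousOn
  have hc : 0 < |(k.factorial : ℝ) * Q ξ| :=
    abs_pos.2 (mul_ne_zero (by exact_mod_cast k.factorial_ne_zero) hξ)
  have hlim := (Filter.tendsto_add_atTop_iff_nat 1).2
    Real.tendsto_sum_range_one_div_nat_succ_atTop
  obtain ⟨N, hN⟩ := (hlim.eventually_gt_atTop (C / |(k.factorial : ℝ) * Q ξ|)).exists
  rw [div_lt_iff₀ hc] at hN
  obtain ⟨x, hx⟩ : ∃ x : E n, ‖x‖ = 3 / 4 / 4 ^ N := by
    refine ⟨(3 / 4 / 4 ^ N / ‖ξ‖ : ℝ) • ξ, ?_⟩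
    rw [norm_smul, Real.norm_of_nonneg (by positivity), div_mul_cancel₀ _ hξ0.ne']
  have h4 : (1 : ℝ) ≤ 4 ^ N := one_le_pow₀ (by norm_num)
  have h1 : 4 ^ N * ‖x‖ = 3 / 4 := by
    rw [hx, mul_div_cancel₀ _ (by positivity)]
  have hx1 : ‖x‖ ≤ 1 := by nlinarith [norm_nonneg x]
  have h2 := hC x (by simpa using hx1)
  rw [dirDeriv_congr (v := fun y => (∑ i ∈ Finset.range (N + 1), 1 / ((i : ℝ) + 1)) * Q y) (by
      filter_upwards [slowGrowth_eventuallyEq (N := N) (x := x) (by linarith)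
        (by rw [pow_succ]; linarith)] with y hy
      rw [hy, mul_comm]), dirDeriv_const_mul (contDiff_infty.1 hQ k),
    dirDeriv_of_homogeneous (contDiff_infty.1 hQ k) hhom, norm_mul, Real.norm_eq_abs,
    Real.norm_eq_abs] at h2
  have h3 := mul_le_mul_of_nonneg_right
    (le_abs_self (∑ i ∈ Finset.range (N + 1), 1 / ((i : ℝ) + 1))) hc.le
  linarith

theorem contDiff_monomial (α : MultiIndex n k) : ContDiff ℝ ∞ (monomial α) := by
  have : (monomial α : E n → ℝ) = fun ξ => ∏ i, ξ i ^ α.1 i := rfl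
  rw [this]
  exact contDiff_prod fun i _ => (contDiff_euclidean.1 contDiff_id i).pow _

theorem monomial_smul (α : MultiIndex n k) (s : ℝ) (ξ : E n) :
    monomial α (s • ξ) = s ^ k * monomial α ξ := by
  simp only [monomial, PiLp.smul_apply, smul_eq_mul, mul_pow, Finset.prod_mul_distrib]
  rw [Finset.prod_pow_eq_pow_sum, α.2]

theorem isLocallyBounded_of_continuous {f : E n → E m} (hf : Continuous f) :
    IsLocallyBounded f := fun x =>
  ⟨f ⁻¹' Metric.ball (f x) 1, hf.continuousAt (Metric.ball_mem_nhds _ one_pos),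
    Metric.isBounded_ball.subset (Set.image_preimage_subset _ _)⟩

theorem notInHypersurface_of_forcesCk {Λ : Set (E n × E m)} (hk : 1 ≤ k) (h : ForcesCk k Λ) :
    NotInHypersurface k Λ := by
  rintro Φ ⟨c, hΦ⟩ hΛ
  by_contra! hne
  obtain ⟨ξ₀, η₀, hne⟩ := hne
  let Q : Fin m → E n → ℝ := fun j ξ => ∑ α, c α j * monomial α ξ
  have hQ : ∀ j, ContDiff ℝ ∞ (Q j) := fun j =>
    ContDiff.sum fun α _ => contDiff_const.mul (contDiff_monomial α)
  have hhom : ∀ j (s : ℝ) x, Q j (s • x) = s ^ k * Q j x := fun j s x => by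
    simp only [Q, monomial_smul, Finset.mul_sum]
    refine Finset.sum_congr rfl fun α _ => ?_
    ring
  have hΦQ : ∀ ξ η, Φ ξ η = ∑ j, η j * Q j ξ := fun ξ η => by
    rw [hΦ]
    simp only [Q, Finset.mul_sum]
    refine Finset.sum_congr rfl fun j _ => Finset.sum_congr rfl fun α _ => ?_
    ring
  obtain ⟨j, hj⟩ : ∃ j, Q j ξ₀ ≠ 0 := by
    by_contra! h0
    exact hne (by simp [hΦQ, h0])
  let f : E n → E m := fun x => WithLp.toLp 2 fun j => Q j x * slowGrowth x
  have hpair : ∀ η, pairing f η = fun x => (∑ j, η j * Q j x) * slowGrowth x := fun η => by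
    rw [pairing_eq_sum]
    funext x
    rw [Finset.sum_mul]
    refine Finset.sum_congr rfl fun j _ => ?_
    simp only [f]
    ring
  have hcoord : ∀ j, Continuous fun x => Q j x * slowGrowth x := fun j =>
    (isDirCk_mul_slowGrowth (hQ j) (hhom j) (ξ := 0) (by
      have := hhom j 0 0
      rwa [zero_smul, zero_pow (by lia), zero_mul] at this)).1
  have hf : Continuous f := (PiLp.continuous_toLp 2 _).comp (continuous_pi hcoord)
  refine not_contDiff_mul_slowGrowth (hQ j) hk (hhom j) hj
    (contDiff_apply_coord (h f (isLocallyBounded_of_continuous hf) fun p hp => ?_) j)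
  rw [hpair]
  refine isDirCk_mul_slowGrowth (ContDiff.sum fun j _ => contDiff_const.mul (hQ j))
    (fun s x => ?_) (by rw [← hΦQ]; exact hΛ p hp)
  simp only [hhom, Finset.mul_sum]
  refine Finset.sum_congr rfl fun j _ => ?_
  ring

theorem exists_bound {Λ : Set (E n × E m)} (h : HasNonsingularPoints k Λ) :
    ∃ B : ℝ≥0,
      (∀ f : E n → E m, IsLocallyBounded f →
        (∀ p ∈ Λ, IsDirCk k p.1 (pairing f p.2)) →
        ∀ (j : Fin m) (α : MultiIndex n k) (x : E n),
          ‖multiDeriv α.1 (fun y => f y j) x‖ₑ ≤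
            (B : ℝ≥0∞) * ⨆ p ∈ Λ, ‖dirDeriv k p.1 (pairing f p.2) x‖ₑ) ∧
      (∀ f : E n → E m, IsLocallyBounded f → AEStronglyMeasurable f volume →
        ∀ g : E n × E m → E n → ℝ,
        (∀ p ∈ Λ, LocallyIntegrable (g p) volume ∧
          IsWeakDirDeriv k p.1 (pairing f p.2) (g p)) →
        ∀ (j : Fin m) (α : MultiIndex n k),
          ∃ h : E n → ℝ, LocallyIntegrable h volume ∧
            IsWeakMultiDeriv α.1 (fun y => f y j) h ∧
            ((∀ p ∈ Λ, Continuous (g p)) → Continuous h) ∧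
            ∀ x, ‖h x‖ₑ ≤ (B : ℝ≥0∞) * ⨆ p ∈ Λ, ‖g p x‖ₑ) := by
  obtain ⟨P, hP, A, hA⟩ := exists_dual_coefficients h
  let B : ℝ≥0 := ∑ α, ∑ j, ∑ p, ‖(wordCount α : ℝ)⁻¹ * A α j p‖₊
  have hB : ∀ α j, ((∑ p, ‖(wordCount α : ℝ)⁻¹ * A α j p‖₊ : ℝ≥0) : ℝ≥0∞) ≤ B := fun α j => by
    refine ENNReal.coe_le_coe.2 ?_
    refine (Finset.single_le_sum (f := fun j => ∑ p, ‖(wordCount α : ℝ)⁻¹ * A α j p‖₊)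
      (fun _ _ => zero_le) (Finset.mem_univ j)).trans ?_
    exact Finset.single_le_sum (f := fun α => ∑ j, ∑ p, ‖(wordCount α : ℝ)⁻¹ * A α j p‖₊)
      (fun _ _ => zero_le) (Finset.mem_univ α)
  have hbound : ∀ α j (v : E n × E m → ℝ),
      ‖∑ p, (wordCount α : ℝ)⁻¹ * A α j p * v (P p)‖ₑ ≤ (B : ℝ≥0∞) * ⨆ q ∈ Λ, ‖v q‖ₑ :=
    fun α j v => (enorm_sum_mul_le_iSup hP _ v).trans (mul_le_mul_left (hB α j) _)
  refine ⟨B, fun f hf hd j α x => ?_, fun f hf hm g hg j α => ?_⟩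
  · rw [multiDeriv_eq_sum_dirDeriv hA (forcesCk_of_hasNonsingularPoints h f hf hd)]
    exact hbound α j fun q => dirDeriv k q.1 (pairing f q.2) x
  · refine ⟨fun x => ∑ p, (wordCount α : ℝ)⁻¹ * A α j p * g (P p) x, ?_,
      isWeakMultiDeriv_of_isWeakDirDeriv hA (hf.locallyIntegrable_coord hm)
        (fun p => (hg _ (hP p)).1) (fun p => (hg _ (hP p)).2) α j,
      fun hc => continuous_finsetSum _ fun p _ => continuous_const.mul (hc _ (hP p)),
      fun x => hbound α j fun q => g q x⟩
    exact locallyIntegrable_finsetSum _ fun p _ => (hg _ (hP p)).1.smul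
      ((wordCount α : ℝ)⁻¹ * A α j p)

end PartialRegularity

theorem theorem1 (n m k : ℕ) (hk : 1 ≤ k)
    (Λ : Set (PartialRegularity.E n × PartialRegularity.E m)) :
    [PartialRegularity.NotInHypersurface k Λ,
      PartialRegularity.HasNonsingularPoints k Λ,
      PartialRegularity.ForcesCk k Λ].TFAE ∧
    (PartialRegularity.NotInHypersurface k Λ ∨ PartialRegularity.HasNonsingularPoints k Λ ∨
        PartialRegularity.ForcesCk k Λ →
      ∃ B : ℝ≥0,
        (∀ f : PartialRegularity.E n → PartialRegularity.E m,
          PartialRegularity.IsLocallyBounded f →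
          (∀ p ∈ Λ, PartialRegularity.IsDirCk k p.1 (PartialRegularity.pairing f p.2)) →
          ∀ (j : Fin m) (α : PartialRegularity.MultiIndex n k) (x : PartialRegularity.E n),
            ‖PartialRegularity.multiDeriv α.1 (fun y => f y j) x‖ₑ ≤
              (B : ℝ≥0∞) * ⨆ p ∈ Λ,
                ‖PartialRegularity.dirDeriv k p.1 (PartialRegularity.pairing f p.2) x‖ₑ) ∧
        (∀ f : PartialRegularity.E n → PartialRegularity.E m,
          PartialRegularity.IsLocallyBounded f → AEStronglyMeasurable f volume →
          ∀ g : PartialRegularity.E n × PartialRegularity.E m → PartialRegularity.E n → ℝ,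
          (∀ p ∈ Λ, LocallyIntegrable (g p) volume ∧
            PartialRegularity.IsWeakDirDeriv k p.1 (PartialRegularity.pairing f p.2) (g p)) →
          ∀ (j : Fin m) (α : PartialRegularity.MultiIndex n k),
            ∃ h : PartialRegularity.E n → ℝ, LocallyIntegrable h volume ∧
              PartialRegularity.IsWeakMultiDeriv α.1 (fun y => f y j) h ∧
              ((∀ p ∈ Λ, Continuous (g p)) → Continuous h) ∧
              ∀ x, ‖h x‖ₑ ≤ (B : ℝ≥0∞) * ⨆ p ∈ Λ, ‖g p x‖ₑ)) := by
  have h12 : PartialRegularity.NotInHypersurface k Λ ↔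
      PartialRegularity.HasNonsingularPoints k Λ :=
    PartialRegularity.notInHypersurface_iff_hasNonsingularPoints
  have h23 : PartialRegularity.HasNonsingularPoints k Λ → PartialRegularity.ForcesCk k Λ :=
    PartialRegularity.forcesCk_of_hasNonsingularPoints
  have h31 : PartialRegularity.ForcesCk k Λ → PartialRegularity.NotInHypersurface k Λ :=
    PartialRegularity.notInHypersurface_of_forcesCk hk
  refine ⟨?_, fun h => PartialRegularity.exists_bound ?_⟩
  · tfae_have 1 ↔ 2 := h12
    tfae_have 2 → 3 := h23
    tfae_have 3 → 1 := h31
    tfae_finish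
  · rcases h with h | h | h
    · exact h12.1 h
    · exact h
    · exact h12.1 (h31 h)
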